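/- Let $n>d\ge 0$ be integers. Let $G_{\mathcal N}$ be the group of pairs $(V,m)$, where $V\in\mathbb R^{d\times d}$ is upper triangular with positive diagonal and $m\in\mathbb R^d$, with product $(V_2,m_2)(V_1,m_1)=(V_2V_1,\,V_2m_1+m_2)$ and the topology (and smooth structure) of a subset of $\mathbb R^{d\times d}\times\mathbb R^d$. It acts on $\mathbb R^d$ by $(V,m)\cdot y=Vy+m$ and element-wise on $(\mathbb R^d)^n$. A standard Borel probability space $(X,\mu)$ is *orbit-regular* under an action of a locally compact $\sigma$-compact group $G$, with exceptional set $X_0$, if 1. $X_0\subseteq X$ is a closed union of orbits, $\mu(X_0)=0$, and $G$ acts freely on $X\setminus X_0$; 2. with $\pi: X\setminus X_0\to Y=(X\setminus X_0)/G$ the quotient map ($Y$ with the Borel $\sigma$-algebra of the quotient topology) and $\nu=\pi_*\mu$, there is a measurable family $(\mu_y)_{y\in Y}$ of measures on $X\setminus X_0$ such that $\mu_y$ is a probability measure concentrated on $\pi^{-1}(y)$ for $\nu$-almost every $y$, $\int f\,d\mu=\int_Y\int f\,d\mu_y\,d\nu(y)$ for all measurable $f\ge 0$ on $X\setminus X_0$,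 and for every $x\in X\setminus X_0$ the measure $\mu_{\pi(x)}$ is mutually absolutely continuous with the image of the left Haar measure of $G$ under $g\mapsto gx$. Call $x=(x_1,\dots,x_n)\in(\mathbb R^d)^n$ *in general position* if no $d+1$ of the points $x_1,\dots,x_n$ are affinely dependent, and let $X_0$ be the set of $x$ that are not in general position. Put $$\bar x=\frac1n\sum_{i=1}^n x_i,\qquad \bar\Sigma=\frac1{n-1}\sum_{i=1}^n(x_i-\bar x)(x_i-\bar x)^T$$ (for $d=0$, $\bar\Sigma$ is the empty matrix), let $\bar\Sigma^{1/2}$ be the upper triangular Cholesky factor of $\bar\Sigma$ (upper triangular, positive diagonal, $\bar\Sigma^{1/2}(\bar\Sigma^{1/2})^T=\bar\Sigma$), let $w(x)=\big(\bar\Sigma^{-1/2}(x_i-\bar x)\big)_{i=1}^n$, where $\bar\Sigma^{-1/2}=(\bar\Sigma^{1/2})^{-1}$, and let $$N=\{x\in(\mathbb R^d)^n\setminus X_0:\ \bar x=0,\ \bar\Sigma=I\}.$$ Then: (a) For all $a_1,\dots,a_n\in\mathbb R^d$ and symmetric positive definite $S_1,\dots,S_n\in\mathbb R^{d\times d}$,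 the space $(\mathbb R^d)^n$ with the measure $\bigotimes_{i=1}^n\mathcal N(a_i,S_i)$ is orbit-regular under $G_{\mathcal N}$ with exceptional set $X_0$. (b) $N$ is an embedded smooth submanifold of $(\mathbb R^d)^n$ of dimension $k=nd-d-\frac{d(d+1)}2$. (c) The map $x\mapsto\big(w(x),(\bar\Sigma^{1/2},\bar x)\big)$ is a diffeomorphism from $(\mathbb R^d)^n\setminus X_0$ onto $N\times G_{\mathcal N}$, with inverse $(y,(V,m))\mapsto(Vy_i+m)_{i=1}^n$. (d) Sending $y\in N$ to its orbit is a homeomorphism from $N$ onto $\big((\mathbb R^d)^n\setminus X_0\big)/G_{\mathcal N}$. Under this identification the quotient map is $w$, and $w$ is a submersion onto $N$ (its derivative has rank $k=\dim N$ at every point of $(\mathbb R^d)^n\setminus X_0$). -/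

import Mathlib

open MeasureTheory ProbabilityTheory Topology Set
open scoped Matrix ContDiff ENNReal

/-! ### Orbit spaces, disintegrations and orbit regularity -/

/-- The orbit space `X / G`; it carries the quotient topology and the Borel σ-algebra of
that topology. -/
def OrbitSpace (G X : Type*) [Group G] [MulAction G X] : Type _ :=
  Quotient (MulAction.orbitRel G X)

/-- The quotient map `X → X / G`. -/
def OrbitSpace.mk (G : Type*) {X : Type*} [Group G] [MulAction G X] (x : X) : OrbitSpace G X :=
  Quotient.mk (MulAction.orbitRel G X) x

instance OrbitSpace.instTopologicalSpace (G X : Type*) [Group G] [MulAction G X]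
    [TopologicalSpace X] : TopologicalSpace (OrbitSpace G X) :=
  inferInstanceAs (TopologicalSpace (Quotient (MulAction.orbitRel G X)))

instance OrbitSpace.instMeasurableSpace (G X : Type*) [Group G] [MulAction G X]
    [TopologicalSpace X] : MeasurableSpace (OrbitSpace G X) :=
  borel _

instance OrbitSpace.instBorelSpace (G X : Type*) [Group G] [MulAction G X]
    [TopologicalSpace X] : BorelSpace (OrbitSpace G X) :=
  ⟨rfl⟩

/-- `κ` is a disintegration of `μ` along `π`: with `ν` the image of `μ` under `π`, for `ν`-almost
every `y` the measure `κ y` is a probability measure concentrated on the fibre over `y`, and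
`μ = ∫ κ y dν(y)`. -/
structure IsDisintegration {X Y : Type*} [MeasurableSpace X] [MeasurableSpace Y]
    (μ : Measure X) (π : X → Y) (κ : Kernel Y X) : Prop where
  fibre : ∀ᵐ y ∂(μ.map π), IsProbabilityMeasure (κ y) ∧ κ y (π ⁻¹' {y})ᶜ = 0
  lintegral_eq : ∀ f : X → ℝ≥0∞, Measurable f →
    ∫⁻ x, f x ∂μ = ∫⁻ y, ∫⁻ x, f x ∂(κ y) ∂(μ.map π)

/-- Orbit regularity of the standard Borel probability space `(X, μ)` under the locally compact
σ-compact group `G`, with exceptional set `X₀`. A `SubMulAction` of a group is exactly a union of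
orbits, and `X₀ᶜ` is its complement with the restricted action. The left-invariant measure on the
orbit of `x` is the image of the left Haar measure under `g ↦ g • x`; up to a positive constant it
does not depend on the choice of `x` in its orbit. -/
structure IsOrbitRegularWith {G X : Type*} [Group G] [TopologicalSpace G] [IsTopologicalGroup G]
    [LocallyCompactSpace G] [SigmaCompactSpace G] [MeasurableSpace G] [BorelSpace G]
    [TopologicalSpace X] [PolishSpace X] [MeasurableSpace X] [BorelSpace X]
    [MulAction G X] [MeasurableSMul G X]
    (μ : Measure X) [IsProbabilityMeasure μ] (X₀ : SubMulAction G X) : Prop where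
  isClosed : IsClosed (X₀ : Set X)
  null : μ (X₀ : Set X) = 0
  free : ∀ x : X, x ∉ X₀ → ∀ g : G, g • x = x → g = 1
  disintegration : ∃ κ : Kernel (OrbitSpace G ↥X₀ᶜ) ↥X₀ᶜ,
    IsDisintegration (μ.comap (Subtype.val : ↥X₀ᶜ → X)) (OrbitSpace.mk G) κ ∧
    ∀ x : ↥X₀ᶜ,
      κ (OrbitSpace.mk G x) ≪ (Measure.haar : Measure G).map (fun g : G => g • x) ∧
      (Measure.haar : Measure G).map (fun g : G => g • x) ≪ κ (OrbitSpace.mk G x)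

/-- Orbit regularity of the probability space `(X, μ)` under the action of `G`. -/
def IsOrbitRegular (G : Type*) {X : Type*} [Group G] [TopologicalSpace G] [IsTopologicalGroup G]
    [LocallyCompactSpace G] [SigmaCompactSpace G] [MeasurableSpace G] [BorelSpace G]
    [TopologicalSpace X] [PolishSpace X] [MeasurableSpace X] [BorelSpace X]
    [MulAction G X] [MeasurableSMul G X]
    (μ : Measure X) [IsProbabilityMeasure μ] : Prop :=
  ∃ X₀ : SubMulAction G X, IsOrbitRegularWith μ X₀

/-! ### Smooth submanifolds and diffeomorphisms between subsets of normed spaces -/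

/-- `S` is an embedded smooth submanifold of dimension `k`: around each of its points there is a
smooth chart of the ambient space that carries `S` to a `k`-dimensional linear subspace. -/
def IsSmoothSubmanifold {E : Type*} [NormedAddCommGroup E] [NormedSpace ℝ E]
    (k : ℕ) (S : Set E) : Prop :=
  ∀ x ∈ S, ∃ (e : OpenPartialHomeomorph E E) (K : Submodule ℝ E),
    x ∈ e.source ∧ ContDiffOn ℝ ∞ e e.source ∧ ContDiffOn ℝ ∞ e.symm e.target ∧
    Module.finrank ℝ K = k ∧ ∀ y ∈ e.source, y ∈ S ↔ e y ∈ K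

/-- Smoothness of a map on an arbitrary subset `A`: near each point of `A` it is the restriction
to `A` of a smooth map defined on an open set. -/
def IsSmoothOn {E F : Type*} [NormedAddCommGroup E] [NormedSpace ℝ E]
    [NormedAddCommGroup F] [NormedSpace ℝ F] (f : E → F) (A : Set E) : Prop :=
  ∀ x ∈ A, ∃ (U : Set E) (f' : E → F), IsOpen U ∧ x ∈ U ∧ ContDiffOn ℝ ∞ f' U ∧ EqOn f f' (A ∩ U)

/-- `f` restricts to a diffeomorphism from `A` onto `B` with inverse `f'`. -/
structure IsDiffeoOn {E F : Type*} [NormedAddCommGroup E] [NormedSpace ℝ E]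
    [NormedAddCommGroup F] [NormedSpace ℝ F] (f : E → F) (f' : F → E)
    (A : Set E) (B : Set F) : Prop where
  mapsTo : MapsTo f A B
  mapsTo_inv : MapsTo f' B A
  invOn : InvOn f' f A B
  smoothOn : IsSmoothOn f A
  smoothOn_inv : IsSmoothOn f' B

/-! ### The group `G_𝒩` -/

/-- Upper triangular with positive diagonal entries. -/
def IsUpperPos {d : ℕ} (V : Matrix (Fin d) (Fin d) ℝ) : Prop :=
  V.BlockTriangular id ∧ ∀ i, 0 < V i i

theorem IsUpperPos.isUnit_det {d : ℕ} {V : Matrix (Fin d) (Fin d) ℝ} (h : IsUpperPos V) :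
    IsUnit V.det := by
  rw [Matrix.det_of_isUpperTriangular h.1]
  exact (Finset.prod_pos fun i _ => h.2 i).ne'.isUnit

theorem mul_apply_diag_of_upper {d : ℕ} {V W : Matrix (Fin d) (Fin d) ℝ}
    (hV : V.BlockTriangular id) (hW : W.BlockTriangular id) (i : Fin d) :
    (V * W) i i = V i i * W i i := by
  rw [Matrix.mul_apply]
  refine Finset.sum_eq_single i (fun j _ hj => ?_) (by simp)
  rcases lt_or_gt_of_ne hj with h | h
  · rw [hV h, zero_mul]
  · rw [hW h, mul_zero]

theorem IsUpperPos.mul {d : ℕ} {V W : Matrix (Fin d) (Fin d) ℝ} (hV : IsUpperPos V)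
    (hW : IsUpperPos W) : IsUpperPos (V * W) :=
  ⟨hV.1.mul hW.1, fun i => by rw [mul_apply_diag_of_upper hV.1 hW.1]; exact mul_pos (hV.2 i) (hW.2 i)⟩

theorem IsUpperPos.one {d : ℕ} : IsUpperPos (1 : Matrix (Fin d) (Fin d) ℝ) :=
  ⟨Matrix.blockTriangular_one, fun i => by simp⟩

theorem IsUpperPos.inv {d : ℕ} {V : Matrix (Fin d) (Fin d) ℝ} (h : IsUpperPos V) :
    IsUpperPos V⁻¹ := by
  have := Matrix.invertibleOfIsUnitDet V h.isUnit_det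
  have h1 : V⁻¹.BlockTriangular id := Matrix.blockTriangular_inv_of_blockTriangular h.1
  refine ⟨h1, fun i => ?_⟩
  have h2 : V i i * V⁻¹ i i = 1 := by
    rw [← mul_apply_diag_of_upper h.1 h1, Matrix.mul_nonsing_inv _ h.isUnit_det, Matrix.one_apply_eq]
  exact pos_of_mul_pos_right (by rw [h2]; exact one_pos) (h.2 i).le

/-- The group of pairs `(V, m)`, with `V` upper triangular with positive diagonal and `m ∈ ℝᵈ`. -/
@[ext]
structure GN (d : ℕ) where
  V : Matrix (Fin d) (Fin d) ℝ
  m : EuclideanSpace ℝ (Fin d)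
  isUpperPos : IsUpperPos V

namespace GN

/-- `V y` for a matrix `V` and a vector `y` of Euclidean space. -/
noncomputable def act {d : ℕ} (V : Matrix (Fin d) (Fin d) ℝ) (y : EuclideanSpace ℝ (Fin d)) :
    EuclideanSpace ℝ (Fin d) :=
  WithLp.toLp 2 (V *ᵥ y.ofLp)

theorem act_mul {d : ℕ} (V W : Matrix (Fin d) (Fin d) ℝ) (y : EuclideanSpace ℝ (Fin d)) :
    act (V * W) y = act V (act W y) := by
  simp [act, Matrix.mulVec_mulVec]

theorem act_one {d : ℕ} (y : EuclideanSpace ℝ (Fin d)) :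
    act (1 : Matrix (Fin d) (Fin d) ℝ) y = y := by
  simp [act]

theorem act_add {d : ℕ} (V : Matrix (Fin d) (Fin d) ℝ) (x y : EuclideanSpace ℝ (Fin d)) :
    act V (x + y) = act V x + act V y := by
  simp [act, Matrix.mulVec_add]

theorem act_neg {d : ℕ} (V : Matrix (Fin d) (Fin d) ℝ) (x : EuclideanSpace ℝ (Fin d)) :
    act V (-x) = -act V x := by
  simp [act, Matrix.mulVec_neg]

/-- `(V₂, m₂) · (V₁, m₁) = (V₂ V₁, V₂ m₁ + m₂)`. -/
noncomputable instance instMul (d : ℕ) : Mul (GN d) :=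
  ⟨fun g h => ⟨g.V * h.V, act g.V h.m + g.m, g.isUpperPos.mul h.isUpperPos⟩⟩

noncomputable instance instOne (d : ℕ) : One (GN d) := ⟨⟨1, 0, IsUpperPos.one⟩⟩

noncomputable instance instInv (d : ℕ) : Inv (GN d) :=
  ⟨fun g => ⟨g.V⁻¹, -act g.V⁻¹ g.m, g.isUpperPos.inv⟩⟩

noncomputable instance instGroup (d : ℕ) : Group (GN d) :=
  Group.ofLeftAxioms
    (fun a b c => by
      apply GN.ext
      · exact Matrix.mul_assoc _ _ _
      · change act (a.V * b.V) c.m + (act a.V b.m + a.m) = act a.V (act b.V c.m + b.m) + a.m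
        rw [act_mul, act_add, add_assoc])
    (fun a => by
      apply GN.ext
      · exact Matrix.one_mul _
      · change act 1 a.m + 0 = a.m
        rw [act_one, add_zero])
    (fun a => by
      apply GN.ext
      · exact Matrix.nonsing_inv_mul _ a.isUpperPos.isUnit_det
      · change act a.V⁻¹ a.m + -act a.V⁻¹ a.m = 0
        rw [add_neg_cancel])

theorem mul_V {d : ℕ} (g h : GN d) : (g * h).V = g.V * h.V := rfl
theorem mul_m {d : ℕ} (g h : GN d) : (g * h).m = act g.V h.m + g.m := rfl
theorem one_V {d : ℕ} : (1 : GN d).V = 1 := rfl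
theorem one_m {d : ℕ} : (1 : GN d).m = 0 := rfl
theorem inv_V {d : ℕ} (g : GN d) : (g⁻¹).V = g.V⁻¹ := rfl
theorem inv_m {d : ℕ} (g : GN d) : (g⁻¹).m = -act g.V⁻¹ g.m := rfl

/-- `G_𝒩` as a subset of the space of pairs (matrix, vector). -/
def coords {d : ℕ} (g : GN d) : Matrix (Fin d) (Fin d) ℝ × EuclideanSpace ℝ (Fin d) :=
  (g.V, g.m)

instance instTopologicalSpace (d : ℕ) : TopologicalSpace (GN d) :=
  TopologicalSpace.induced coords inferInstance

instance instMeasurableSpace (d : ℕ) : MeasurableSpace (GN d) := borel _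

instance instBorelSpace (d : ℕ) : BorelSpace (GN d) := ⟨rfl⟩

theorem isEmbedding_coords (d : ℕ) : IsEmbedding (coords (d := d)) :=
  ⟨⟨rfl⟩, fun _ _ e => GN.ext (congrArg Prod.fst e) (congrArg Prod.snd e)⟩

theorem range_coords (d : ℕ) :
    range (coords (d := d)) = {p | IsUpperPos p.1} := by
  ext p
  exact ⟨by rintro ⟨g, rfl⟩; exact g.isUpperPos, fun h => ⟨⟨p.1, p.2, h⟩, rfl⟩⟩

theorem continuous_V (d : ℕ) : Continuous (GN.V (d := d)) :=
  continuous_fst.comp (isEmbedding_coords d).continuous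

theorem continuous_m (d : ℕ) : Continuous (GN.m (d := d)) :=
  continuous_snd.comp (isEmbedding_coords d).continuous

theorem continuous_act {d : ℕ} {T : Type*} [TopologicalSpace T]
    {V : T → Matrix (Fin d) (Fin d) ℝ} {y : T → EuclideanSpace ℝ (Fin d)}
    (hV : Continuous V) (hy : Continuous y) : Continuous fun t => act (V t) (y t) :=
  (PiLp.continuous_toLp 2 _).comp
    (hV.matrix_mulVec ((PiLp.continuous_ofLp 2 _).comp hy))

theorem continuous_inv_V (d : ℕ) : Continuous fun g : GN d => g.V⁻¹ :=
  continuous_iff_continuousAt.2 fun g =>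
    ContinuousAt.comp (f := GN.V) (g := fun A : Matrix (Fin d) (Fin d) ℝ => A⁻¹)
      (continuousAt_matrix_inv _ (by
        rw [Ring.inverse_eq_inv']
        exact continuousAt_inv₀ g.isUpperPos.isUnit_det.ne_zero))
      (continuous_V d).continuousAt

instance instIsTopologicalGroup (d : ℕ) : IsTopologicalGroup (GN d) where
  continuous_mul := (isEmbedding_coords d).continuous_iff.2 <|
    (((continuous_V d).comp continuous_fst).matrix_mul
      ((continuous_V d).comp continuous_snd)).prodMk
      ((continuous_act ((continuous_V d).comp continuous_fst)
        ((continuous_m d).comp continuous_snd)).add ((continuous_m d).comp continuous_fst))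
  continuous_inv := (isEmbedding_coords d).continuous_iff.2 <|
    (continuous_inv_V d).prodMk (continuous_act (continuous_inv_V d) (continuous_m d)).neg

theorem isLocallyClosed_range_coords (d : ℕ) : IsLocallyClosed (range (coords (d := d))) := by
  have hc : ∀ i j, Continuous fun p : Matrix (Fin d) (Fin d) ℝ × EuclideanSpace ℝ (Fin d) =>
      p.1 i j := fun i j => continuous_fst.matrix_elem i j
  have h : range (coords (d := d)) =
      (⋂ i, {p | 0 < p.1 i i}) ∩ ⋂ i, ⋂ j, {p | j < i → p.1 i j = 0} := by
    rw [range_coords]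
    ext p
    simp only [IsUpperPos, Matrix.BlockTriangular, mem_ofPred_eq, mem_inter_iff, mem_iInter, id]
    exact ⟨fun h => ⟨h.2, fun i j hij => h.1 hij⟩, fun h => ⟨fun i j hij => h.2 hij, h.1⟩⟩
  rw [h]
  refine IsLocallyClosed.inter (IsOpen.isLocallyClosed ?_) (IsClosed.isLocallyClosed ?_)
  · exact isOpen_iInter_of_finite fun i => isOpen_lt continuous_const (hc i i)
  · refine isClosed_iInter fun i => isClosed_iInter fun j => ?_
    by_cases hij : j < i
    · simpa [hij] using isClosed_eq (hc i j) continuous_const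
    · simp [hij]

instance instLocallyCompactSpace (d : ℕ) : LocallyCompactSpace (GN d) :=
  haveI : LocallyCompactSpace (Matrix (Fin d) (Fin d) ℝ) :=
    inferInstanceAs (LocallyCompactSpace (Fin d → Fin d → ℝ))
  (isEmbedding_coords d).isInducing.locallyCompactSpace (isLocallyClosed_range_coords d)

instance instSecondCountableTopology (d : ℕ) : SecondCountableTopology (GN d) :=
  haveI : SecondCountableTopology (Matrix (Fin d) (Fin d) ℝ) :=
    inferInstanceAs (SecondCountableTopology (Fin d → Fin d → ℝ))
  (isEmbedding_coords d).secondCountableTopology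

/-- The affine action `(V, m) • y = V y + m` on `ℝᵈ`. On configurations `(ℝᵈ)ⁿ`, written
`Fin n → EuclideanSpace ℝ (Fin d)`, the group acts element-wise. -/
noncomputable instance instMulAction (d : ℕ) : MulAction (GN d) (EuclideanSpace ℝ (Fin d)) where
  smul g y := act g.V y + g.m
  one_smul y := by
    change act 1 y + 0 = y
    rw [act_one, add_zero]
  mul_smul g h y := by
    change act (g.V * h.V) y + (act g.V h.m + g.m) = act g.V (act h.V y + h.m) + g.m
    rw [act_mul, act_add, add_assoc]

theorem smul_def {d : ℕ} (g : GN d) (y : EuclideanSpace ℝ (Fin d)) :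
    g • y = act g.V y + g.m := rfl

instance instContinuousSMul (d : ℕ) : ContinuousSMul (GN d) (EuclideanSpace ℝ (Fin d)) where
  continuous_smul := (continuous_act ((continuous_V d).comp continuous_fst) continuous_snd).add
    ((continuous_m d).comp continuous_fst)

end GN

/-! ### Configurations of points -/

/-- No `d + 1` of the `n` points are affinely dependent. -/
def InGeneralPosition {d n : ℕ} (x : Fin n → EuclideanSpace ℝ (Fin d)) : Prop :=
  ∀ s : Finset (Fin n), s.card = d + 1 → AffineIndependent ℝ (fun i : s => x i)

/-- The configurations that are not in general position, as a union of orbits. -/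
noncomputable def specialPosition (d n : ℕ) :
    SubMulAction (GN d) (Fin n → EuclideanSpace ℝ (Fin d)) where
  carrier := {x | ¬ InGeneralPosition x}
  smul_mem' g x hx := fun h => hx fun s hs => by
    let f : EuclideanSpace ℝ (Fin d) →ᵃ[ℝ] EuclideanSpace ℝ (Fin d) :=
      AffineMap.mk' (fun y => g • y) (Matrix.toLpLin 2 2 g.V) 0 fun y => by
        simp only [GN.smul_def, GN.act, vsub_eq_sub, sub_zero, vadd_eq_add]
        ext i
        simp [Matrix.toLpLin_apply]
    exact AffineIndependent.of_comp f (h s hs)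

/-- The sample mean `(1/n) ∑ xᵢ`. -/
noncomputable def sampleMean {d n : ℕ} (x : Fin n → EuclideanSpace ℝ (Fin d)) :
    EuclideanSpace ℝ (Fin d) :=
  (1 / (n : ℝ)) • ∑ i, x i

/-- The sample covariance `(1/(n-1)) ∑ (xᵢ - x̄) (xᵢ - x̄)ᵀ`. -/
noncomputable def sampleCov {d n : ℕ} (x : Fin n → EuclideanSpace ℝ (Fin d)) :
    Matrix (Fin d) (Fin d) ℝ :=
  (1 / ((n : ℝ) - 1)) •
    ∑ i, Matrix.vecMulVec (x i - sampleMean x).ofLp (x i - sampleMean x).ofLp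

open Classical in
/-- The upper triangular Cholesky factor of `S`: the upper triangular matrix `U` with positive
diagonal such that `U Uᵀ = S`. It exists, and is unique, exactly when `S` is symmetric positive
definite; the value `0` is used otherwise. -/
noncomputable def upperCholesky {d : ℕ} (S : Matrix (Fin d) (Fin d) ℝ) :
    Matrix (Fin d) (Fin d) ℝ :=
  if h : ∃ U : Matrix (Fin d) (Fin d) ℝ, IsUpperPos U ∧ U * Uᵀ = S then h.choose else 0

/-- Whitening: `x ↦ (Σ^{-1/2} (xᵢ - x̄))ᵢ`, with `Σ^{1/2}` the upper triangular Cholesky factor of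
the sample covariance. -/
noncomputable def whiten {d n : ℕ} (x : Fin n → EuclideanSpace ℝ (Fin d)) :
    Fin n → EuclideanSpace ℝ (Fin d) :=
  fun i => GN.act (upperCholesky (sampleCov x))⁻¹ (x i - sampleMean x)

/-- The whitened configurations: in general position, with sample mean `0` and sample covariance
the identity. -/
def whitened (d n : ℕ) : Set (Fin n → EuclideanSpace ℝ (Fin d)) :=
  {x | InGeneralPosition x ∧ sampleMean x = 0 ∧ sampleCov x = 1}

/-- The map `x ↦ (whitening of x, (Cholesky factor of the sample covariance, sample mean))`. -/
noncomputable def whitenCoords {d n : ℕ} (x : Fin n → EuclideanSpace ℝ (Fin d)) :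
    (Fin n → EuclideanSpace ℝ (Fin d)) ×
      (Matrix (Fin d) (Fin d) ℝ × EuclideanSpace ℝ (Fin d)) :=
  (whiten x, (upperCholesky (sampleCov x), sampleMean x))

/-- The map `(y, (V, m)) ↦ (V yᵢ + m)ᵢ`. -/
noncomputable def unwhiten {d n : ℕ}
    (p : (Fin n → EuclideanSpace ℝ (Fin d)) ×
      (Matrix (Fin d) (Fin d) ℝ × EuclideanSpace ℝ (Fin d))) :
    Fin n → EuclideanSpace ℝ (Fin d) :=
  fun i => GN.act p.2.1 (p.1 i) + p.2.2

/-- The orbit of a whitened configuration, as a point of the orbit space of the configurations in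
general position. -/
noncomputable def whitenedOrbit (d n : ℕ) (y : whitened d n) :
    OrbitSpace (GN d) ↥(specialPosition d n)ᶜ :=
  OrbitSpace.mk (GN d) ⟨y.1, fun h => h y.2.1⟩

attribute [local instance] Matrix.normedAddCommGroup Matrix.normedSpace

/-! ### Cholesky factorization -/

/-! The pair γ(x) = (Cholesky factor of the sample covariance, sample mean) is a moving frame. The
covariance of gx is VΣVᵀ and its mean is g applied to the mean of x, so uniqueness of the Cholesky
factor gives γ(gx) = gγ(x) (`sampleFrame_smul`). Everything about the action follows from this: w(x)
= γ(x)⁻¹x is constant on orbits, the action is free in general position, N is the set where γ = 1,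
and x ↦ (w(x), γ(x)) is an equivariant bijection onto N × G with inverse (y, g) ↦ gy. General
position enters through `InGeneralPosition.posDef_sampleCov`, which makes γ well defined.

For smoothness, the inverse function theorem shows that the Cholesky factor depends smoothly on the
matrix (`contDiffAt_upperCholesky_comp`). Thus w is a smooth retraction of an open set onto N, and
the fixed set of such a retraction is a submanifold whose dimension is the rank of the derivative
(`isSmoothSubmanifold_of_retraction`). The kernel of dw is the tangent space of the orbit, of
dimension d(d+1)/2 + d, which gives the rank. Continuity of w also makes N homeomorphic to the orbit
space.

For orbit regularity, a product of nondegenerate normal laws has the null sets of Lebesgue measure.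
Hence special position is null (`ae_affineIndependent`) and the law is quasi-invariant under G. In
the coordinates (orbit, γ), a Fubini argument shows that a quasi-invariant measure has the null sets
of (marginal) ⊗ (Haar) (`measure_null_iff_fst_prod_null`). Almost every conditional law is therefore
equivalent to Haar measure, and the kernel can be changed on a null set of orbits to make this hold
everywhere (`exists_kernel_of_quasiInvariant`). -/

/-- Infinitesimal form of Cholesky uniqueness; it makes the derivative of `upperGram` injective. -/
theorem Matrix.BlockTriangular.eq_zero_of_add_transpose {d : ℕ} {A : Matrix (Fin d) (Fin d) ℝ}
    (hA : A.BlockTriangular id) (h : A + Aᵀ = 0) : A = 0 := by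
  ext i j
  have h1 := congrFun (congrFun h i) j
  simp only [Matrix.add_apply, Matrix.transpose_apply, Matrix.zero_apply] at h1 ⊢
  rcases lt_trichotomy i j with hij | rfl | hij
  · rw [hA (show id i < id j from hij), add_zero] at h1
    exact h1
  · linarith
  · exact hA hij

/-- Since Aᵀ = A⁻¹, the matrix Aᵀ is upper triangular too, so A is diagonal; its diagonal entries
are positive with square 1. -/
theorem IsUpperPos.eq_one_of_mul_transpose {d : ℕ} {A : Matrix (Fin d) (Fin d) ℝ}
    (hA : IsUpperPos A) (h : A * Aᵀ = 1) : A = 1 := by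
  have hT : Aᵀ = A⁻¹ := (Matrix.inv_eq_right_inv h).symm
  have hU : Aᵀ.BlockTriangular id := by rw [hT]; exact hA.inv.1
  ext i j
  rcases lt_trichotomy i j with hij | rfl | hij
  · rw [Matrix.one_apply_ne hij.ne]
    exact hU (show id i < id j from hij)
  · have h1 := congrFun (congrFun h i) i
    rw [mul_apply_diag_of_upper hA.1 hU, Matrix.one_apply_eq, Matrix.transpose_apply] at h1
    rw [Matrix.one_apply_eq]
    have := hA.2 i
    nlinarith
  · rw [Matrix.one_apply_ne hij.ne']
    exact hA.1 hij

theorem IsUpperPos.eq_of_mul_transpose_eq {d : ℕ} {U W : Matrix (Fin d) (Fin d) ℝ}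
    (hU : IsUpperPos U) (hW : IsUpperPos W) (h : U * Uᵀ = W * Wᵀ) : U = W := by
  have h1 : W⁻¹ * U = 1 := by
    refine (hW.inv.mul hU).eq_one_of_mul_transpose ?_
    have hWT : IsUnit Wᵀ.det := by rw [Matrix.det_transpose]; exact hW.isUnit_det
    rw [Matrix.transpose_mul, Matrix.transpose_nonsing_inv, ← Matrix.mul_assoc,
      Matrix.mul_assoc W⁻¹, h, ← Matrix.mul_assoc, Matrix.nonsing_inv_mul _ hW.isUnit_det,
      Matrix.one_mul, Matrix.mul_nonsing_inv _ hWT]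
  calc U = W * (W⁻¹ * U) := by
        rw [← Matrix.mul_assoc, Matrix.mul_nonsing_inv _ hW.isUnit_det, Matrix.one_mul]
    _ = W := by rw [h1, Matrix.mul_one]

theorem upperCholesky_eq {d : ℕ} {U S : Matrix (Fin d) (Fin d) ℝ} (hU : IsUpperPos U)
    (h : U * Uᵀ = S) : upperCholesky S = U := by
  have hex : ∃ U : Matrix (Fin d) (Fin d) ℝ, IsUpperPos U ∧ U * Uᵀ = S := ⟨U, hU, h⟩
  rw [upperCholesky, dif_pos hex]
  exact hex.choose_spec.1.eq_of_mul_transpose_eq hU (hex.choose_spec.2.trans h.symm)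

/-- Flipping the signs of columns, that is, multiplying on the right by a diagonal D with D² = 1,
leaves the Gram matrix unchanged. -/
theorem exists_isUpperPos_of_upper {d : ℕ} {U : Matrix (Fin d) (Fin d) ℝ}
    (hU : U.BlockTriangular id) (hdet : U.det ≠ 0) :
    ∃ W : Matrix (Fin d) (Fin d) ℝ, IsUpperPos W ∧ W * Wᵀ = U * Uᵀ := by
  rw [Matrix.det_of_isUpperTriangular hU, Finset.prod_ne_zero_iff] at hdet
  refine ⟨U * Matrix.diagonal fun i => (SignType.sign (U i i) : ℝ),
    ⟨hU.mul (Matrix.blockTriangular_diagonal _), fun i => ?_⟩, ?_⟩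
  · rw [Matrix.mul_diagonal, mul_comm, sign_mul_self]
    exact abs_pos.2 (hdet i (Finset.mem_univ i))
  · rw [Matrix.transpose_mul, Matrix.diagonal_transpose, ← Matrix.mul_assoc,
      Matrix.mul_assoc U, Matrix.diagonal_mul_diagonal]
    have : (fun i => (SignType.sign (U i i) : ℝ) * (SignType.sign (U i i) : ℝ)) = fun _ => 1 := by
      funext i
      rcases lt_or_gt_of_ne (hdet i (Finset.mem_univ i)) with h | h <;> simp [h]
    rw [this, Matrix.diagonal_one, Matrix.mul_one]

theorem Matrix.PosDef.exists_isUpperPos {d : ℕ} {S : Matrix (Fin d) (Fin d) ℝ} (hS : S.PosDef) :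
    ∃ U : Matrix (Fin d) (Fin d) ℝ, IsUpperPos U ∧ U * Uᵀ = S := by
  -- The LDL decomposition has lower triangular factors. Reversing the order of the indices turns
  -- them into upper triangular ones.
  let S' : Matrix (Fin d)ᵒᵈ (Fin d)ᵒᵈ ℝ := S.submatrix OrderDual.ofDual OrderDual.ofDual
  have hS' : S'.PosDef := hS.submatrix OrderDual.ofDual.injective
  let L : Matrix (Fin d) (Fin d) ℝ :=
    (LDL.lowerInv hS').submatrix OrderDual.toDual OrderDual.toDual
  let e : Fin d → ℝ := fun i => LDL.diagEntries hS' (OrderDual.toDual i)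
  have hL : L.BlockTriangular id := fun i j hij => LDL.lowerInv_triangular hS' hij
  have hLu : IsUnit L := by
    have h1 : IsUnit (LDL.lowerInv hS') := isUnit_of_invertible _
    rw [Matrix.isUnit_iff_isUnit_det] at h1 ⊢
    rwa [← Matrix.det_submatrix_equiv_self OrderDual.toDual] at h1
  have hD : Matrix.diagonal e = L * S * Lᵀ := by
    have h1 := congrArg (fun A => A.submatrix OrderDual.toDual OrderDual.toDual)
      (LDL.diag_eq_lowerInv_conj hS')
    exact h1
  have he : ∀ i, 0 < e i := by
    have h1 : (Matrix.diagonal e).PosDef := by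
      rw [hD, ← Matrix.conjTranspose_eq_transpose_of_trivial]
      exact hS.mul_mul_conjTranspose_same (Matrix.vecMul_injective_of_isUnit hLu)
    exact Matrix.posDef_diagonal_iff.1 h1
  have hLd : IsUnit L.det := (Matrix.isUnit_iff_isUnit_det L).1 hLu
  have hLd' : IsUnit Lᵀ.det := by rwa [Matrix.det_transpose]
  have := Matrix.invertibleOfIsUnitDet L hLd
  -- From LSLᵀ = diag(e) one gets S = (L⁻¹√e)(L⁻¹√e)ᵀ. Fixing signs afterwards makes it unnecessary
  -- to know the diagonal of L.
  obtain ⟨W, hW, hWW⟩ := exists_isUpperPos_of_upper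
    (U := L⁻¹ * Matrix.diagonal fun i => √(e i))
    ((Matrix.blockTriangular_inv_of_blockTriangular hL).mul (Matrix.blockTriangular_diagonal _))
    (by
      rw [Matrix.det_mul, Matrix.det_diagonal]
      refine mul_ne_zero ?_ (Finset.prod_ne_zero_iff.2 fun i _ => (Real.sqrt_pos.2 (he i)).ne')
      exact (Matrix.isUnit_nonsing_inv_det L hLd).ne_zero)
  refine ⟨W, hW, hWW.trans ?_⟩
  have hs : (fun i => √(e i) * √(e i)) = e := funext fun i => Real.mul_self_sqrt (he i).le
  rw [Matrix.transpose_mul, Matrix.diagonal_transpose, ← Matrix.mul_assoc,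
    Matrix.mul_assoc L⁻¹, Matrix.diagonal_mul_diagonal, hs, hD, Matrix.transpose_nonsing_inv,
    Matrix.mul_assoc L, ← Matrix.mul_assoc L⁻¹, Matrix.nonsing_inv_mul _ hLd, Matrix.one_mul,
    Matrix.mul_assoc, Matrix.mul_nonsing_inv _ hLd', Matrix.mul_one]

/-! ### Equivariance of the sample mean and covariance -/

namespace GN

theorem act_eq_toLpLin {d : ℕ} (V : Matrix (Fin d) (Fin d) ℝ) (y : EuclideanSpace ℝ (Fin d)) :
    act V y = Matrix.toLpLin 2 2 V y := rfl

theorem act_sub {d : ℕ} (V : Matrix (Fin d) (Fin d) ℝ) (x y : EuclideanSpace ℝ (Fin d)) :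
    act V (x - y) = act V x - act V y := by
  simp [act_eq_toLpLin]

theorem act_smul {d : ℕ} (V : Matrix (Fin d) (Fin d) ℝ) (c : ℝ) (y : EuclideanSpace ℝ (Fin d)) :
    act V (c • y) = c • act V y := by
  simp [act_eq_toLpLin]

theorem act_sum {d : ℕ} {ι : Type*} (s : Finset ι) (V : Matrix (Fin d) (Fin d) ℝ)
    (y : ι → EuclideanSpace ℝ (Fin d)) : act V (∑ i ∈ s, y i) = ∑ i ∈ s, act V (y i) := by
  simp [act_eq_toLpLin]

end GN

section Sample

variable {d n : ℕ}

theorem sampleMean_smul (hn : n ≠ 0) (g : GN d) (x : Fin n → EuclideanSpace ℝ (Fin d)) :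
    sampleMean (g • x) = g • sampleMean x := by
  have hn' : (n : ℝ) ≠ 0 := Nat.cast_ne_zero.2 hn
  simp only [sampleMean, Pi.smul_apply, GN.smul_def, GN.act_smul, GN.act_sum,
    Finset.sum_add_distrib, smul_add, Finset.sum_const, Finset.card_univ, Fintype.card_fin]
  rw [← Nat.cast_smul_eq_nsmul ℝ, smul_smul, one_div_mul_cancel hn', one_smul]

theorem sampleCov_smul (hn : n ≠ 0) (g : GN d) (x : Fin n → EuclideanSpace ℝ (Fin d)) :
    sampleCov (g • x) = g.V * sampleCov x * g.Vᵀ := by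
  have h : ∀ i, ((g • x) i - sampleMean (g • x)).ofLp
      = g.V *ᵥ (x i - sampleMean x).ofLp := fun i => by
    rw [sampleMean_smul hn, Pi.smul_apply, GN.smul_def, GN.smul_def, add_sub_add_right_eq_sub,
      ← GN.act_sub]
    rfl
  simp only [sampleCov, h]
  rw [Matrix.mul_smul, Matrix.smul_mul, Matrix.mul_sum, Matrix.sum_mul]
  congr 1
  refine Finset.sum_congr rfl fun i _ => ?_
  rw [Matrix.mul_vecMulVec, Matrix.vecMulVec_mul, Matrix.vecMul_transpose]

theorem sampleCov_transpose (x : Fin n → EuclideanSpace ℝ (Fin d)) :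
    (sampleCov x)ᵀ = sampleCov x := by
  simp [sampleCov, Matrix.transpose_sum, Matrix.transpose_vecMulVec]

theorem InGeneralPosition.exists_affineIndependent (hnd : d < n)
    {x : Fin n → EuclideanSpace ℝ (Fin d)} (hx : InGeneralPosition x) :
    ∃ s : Finset (Fin n), s.card = d + 1 ∧ AffineIndependent ℝ (fun i : s => x i) := by
  obtain ⟨s, -, hs⟩ := Finset.exists_subset_card_eq (s := (Finset.univ : Finset (Fin n)))
    (n := d + 1) (by simpa using hnd)
  exact ⟨s, hs, hx s hs⟩

/-- The differences of d + 1 affinely independent points span the whole space, and v is orthogonal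
to all of them. -/
theorem InGeneralPosition.eq_zero_of_inner_const (hnd : d < n)
    {x : Fin n → EuclideanSpace ℝ (Fin d)} (hx : InGeneralPosition x)
    {v c : EuclideanSpace ℝ (Fin d)} (hv : ∀ i, inner ℝ v (x i - c) = 0) : v = 0 := by
  obtain ⟨s, hs, ha⟩ := hx.exists_affineIndependent hnd
  have htop : vectorSpan ℝ (Set.range fun i : s => x i) = ⊤ :=
    ha.vectorSpan_eq_top_of_card_eq_finrank_add_one (by simp [hs])
  have hle : vectorSpan ℝ (Set.range fun i : s => x i) ≤ (ℝ ∙ v)ᗮ := by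
    rw [vectorSpan_def, Submodule.span_le]
    rintro _ ⟨_, ⟨i, rfl⟩, _, ⟨j, rfl⟩, rfl⟩
    simp only [SetLike.mem_coe, vsub_eq_sub]
    rw [Submodule.mem_orthogonal_singleton_iff_inner_right]
    have h1 : x i - x j = (x i - c) - (x j - c) := by abel
    rw [h1, inner_sub_right, hv, hv, sub_zero]
  rw [htop, top_le_iff] at hle
  have : v ∈ (ℝ ∙ v)ᗮ := hle ▸ Submodule.mem_top
  rwa [Submodule.mem_orthogonal_singleton_iff_inner_right, inner_self_eq_zero] at this

theorem InGeneralPosition.posDef_sampleCov (hnd : d < n)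
    {x : Fin n → EuclideanSpace ℝ (Fin d)} (hx : InGeneralPosition x) :
    (sampleCov x).PosDef := by
  refine Matrix.PosDef.of_dotProduct_mulVec_pos ?_ fun v hv => ?_
  · rw [Matrix.IsHermitian, Matrix.conjTranspose_eq_transpose_of_trivial, sampleCov_transpose]
  -- For d = 0 there is no nonzero v; otherwise n > 1, so the factor 1/(n-1) is positive.
  have hd : 0 < d := by
    rcases Nat.eq_zero_or_pos d with rfl | h
    · exact absurd (Subsingleton.elim v 0) hv
    · exact h
  have hn : (0 : ℝ) < 1 / ((n : ℝ) - 1) := by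
    have : (1 : ℝ) < n := by exact_mod_cast (show 1 < n by omega)
    exact one_div_pos.2 (by linarith)
  have key : star v ⬝ᵥ sampleCov x *ᵥ v = 1 / ((n : ℝ) - 1) *
      ∑ i, (inner ℝ (WithLp.toLp 2 v) (x i - sampleMean x)) ^ 2 := by
    simp only [sampleCov, Matrix.smul_mulVec, Matrix.sum_mulVec, dotProduct_smul, smul_eq_mul,
      dotProduct_sum, Matrix.vecMulVec_mulVec]
    congr 1
    refine Finset.sum_congr rfl fun i _ => ?_
    rw [EuclideanSpace.inner_eq_star_dotProduct]
    simp only [star_trivial, MulOpposite.smul_eq_mul_unop, MulOpposite.unop_op]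
    rw [sq, dotProduct_comm v]
  rw [key]
  refine mul_pos hn ?_
  by_contra hcon
  have h0 : ∑ i, (inner ℝ (WithLp.toLp 2 v) (x i - sampleMean x)) ^ 2 = 0 :=
    le_antisymm (not_lt.1 hcon) (Finset.sum_nonneg fun i _ => sq_nonneg _)
  rw [Finset.sum_eq_zero_iff_of_nonneg fun i _ => sq_nonneg _] at h0
  have := hx.eq_zero_of_inner_const hnd (v := WithLp.toLp 2 v) (c := sampleMean x)
    fun i => by simpa using h0 i (Finset.mem_univ i)
  exact hv (by simpa using this)

theorem isUpperPos_upperCholesky {S : Matrix (Fin d) (Fin d) ℝ} (hS : S.PosDef) :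
    IsUpperPos (upperCholesky S) := by
  obtain ⟨U, hU, h⟩ := hS.exists_isUpperPos
  rwa [upperCholesky_eq hU h]

theorem upperCholesky_mul_transpose {S : Matrix (Fin d) (Fin d) ℝ} (hS : S.PosDef) :
    upperCholesky S * (upperCholesky S)ᵀ = S := by
  obtain ⟨U, hU, h⟩ := hS.exists_isUpperPos
  rwa [upperCholesky_eq hU h]

/-! ### The whitening element of the group -/

theorem inGeneralPosition_smul_iff (g : GN d) (x : Fin n → EuclideanSpace ℝ (Fin d)) :
    InGeneralPosition (g • x) ↔ InGeneralPosition x :=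
  not_iff_not.1 ((specialPosition d n).smul_mem_iff' g)

/-- The pair (Cholesky factor of the sample covariance, sample mean), as a group element. -/
noncomputable def sampleFrame (hnd : d < n) (x : Fin n → EuclideanSpace ℝ (Fin d))
    (hx : InGeneralPosition x) : GN d :=
  ⟨upperCholesky (sampleCov x), sampleMean x, isUpperPos_upperCholesky (hx.posDef_sampleCov hnd)⟩

/-- The product g · γ(x) is upper triangular with positive diagonal and has Gram matrix VΣVᵀ, so it
is the Cholesky factor by uniqueness. -/
theorem sampleFrame_smul (hnd : d < n) (g : GN d) (x : Fin n → EuclideanSpace ℝ (Fin d))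
    (hx : InGeneralPosition x) (hgx : InGeneralPosition (g • x)) :
    sampleFrame hnd (g • x) hgx = g * sampleFrame hnd x hx := by
  have hn : n ≠ 0 := by omega
  apply GN.ext
  · refine upperCholesky_eq (g * sampleFrame hnd x hx).isUpperPos ?_
    rw [sampleCov_smul hn]
    change (g.V * upperCholesky (sampleCov x)) * (g.V * upperCholesky (sampleCov x))ᵀ = _
    rw [Matrix.transpose_mul, ← Matrix.mul_assoc, Matrix.mul_assoc g.V,
      upperCholesky_mul_transpose (hx.posDef_sampleCov hnd)]
  · exact sampleMean_smul hn g x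

theorem sampleFrame_of_mem_whitened (hnd : d < n) {x : Fin n → EuclideanSpace ℝ (Fin d)}
    (hx : x ∈ whitened d n) : sampleFrame hnd x hx.1 = 1 := by
  apply GN.ext
  · exact upperCholesky_eq IsUpperPos.one
      (by rw [hx.2.2, GN.one_V, Matrix.transpose_one, Matrix.one_mul])
  · exact hx.2.1

theorem whiten_eq_smul (hnd : d < n) (x : Fin n → EuclideanSpace ℝ (Fin d))
    (hx : InGeneralPosition x) : whiten x = (sampleFrame hnd x hx)⁻¹ • x := by
  funext i
  rw [Pi.smul_apply, GN.smul_def, GN.inv_V, GN.inv_m, ← sub_eq_add_neg, ← GN.act_sub]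
  rfl

theorem sampleFrame_smul_whiten (hnd : d < n) (x : Fin n → EuclideanSpace ℝ (Fin d))
    (hx : InGeneralPosition x) : sampleFrame hnd x hx • whiten x = x := by
  rw [whiten_eq_smul hnd x hx, smul_inv_smul]

theorem whiten_mem_whitened (hnd : d < n) (x : Fin n → EuclideanSpace ℝ (Fin d))
    (hx : InGeneralPosition x) : whiten x ∈ whitened d n := by
  have hn : n ≠ 0 := by omega
  have hw : InGeneralPosition (whiten x) := by
    rw [whiten_eq_smul hnd x hx, inGeneralPosition_smul_iff]
    exact hx
  -- By equivariance γ(γ(x)⁻¹x) = γ(x)⁻¹γ(x) = 1, which encodes mean zero and identity covariance at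
  -- once.
  have h1 : sampleFrame hnd (whiten x) hw = 1 := by
    have h2 : InGeneralPosition ((sampleFrame hnd x hx)⁻¹ • x) := by
      rwa [inGeneralPosition_smul_iff]
    have h3 := sampleFrame_smul hnd (sampleFrame hnd x hx)⁻¹ x hx h2
    rw [inv_mul_cancel] at h3
    rw [← h3]
    congr 1
    exact whiten_eq_smul hnd x hx
  have hV : upperCholesky (sampleCov (whiten x)) = 1 := congrArg GN.V h1
  refine ⟨hw, congrArg GN.m h1, ?_⟩
  rw [← upperCholesky_mul_transpose (hw.posDef_sampleCov hnd), hV]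
  simp

theorem whiten_smul (hnd : d < n) (g : GN d) (x : Fin n → EuclideanSpace ℝ (Fin d))
    (hx : InGeneralPosition x) : whiten (g • x) = whiten x := by
  have hgx : InGeneralPosition (g • x) := (inGeneralPosition_smul_iff g x).2 hx
  rw [whiten_eq_smul hnd _ hgx, whiten_eq_smul hnd x hx, sampleFrame_smul hnd g x hx hgx,
    mul_inv_rev, mul_smul, inv_smul_smul]

theorem whiten_of_mem_whitened (hnd : d < n) {x : Fin n → EuclideanSpace ℝ (Fin d)}
    (hx : x ∈ whitened d n) : whiten x = x := by
  rw [whiten_eq_smul hnd x hx.1, sampleFrame_of_mem_whitened hnd hx, inv_one, one_smul]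

theorem InGeneralPosition.eq_one_of_smul_eq (hnd : d < n) {x : Fin n → EuclideanSpace ℝ (Fin d)}
    (hx : InGeneralPosition x) {g : GN d} (hg : g • x = x) : g = 1 := by
  have hgx : InGeneralPosition (g • x) := (inGeneralPosition_smul_iff g x).2 hx
  have h := sampleFrame_smul hnd g x hx hgx
  have h' : sampleFrame hnd (g • x) hgx = sampleFrame hnd x hx := by congr 1
  rw [h'] at h
  exact right_eq_mul.1 h

theorem unwhiten_coords (y : Fin n → EuclideanSpace ℝ (Fin d)) (g : GN d) :
    unwhiten (y, g.coords) = g • y := rfl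

theorem whitenCoords_eq (hnd : d < n) (x : Fin n → EuclideanSpace ℝ (Fin d))
    (hx : InGeneralPosition x) :
    whitenCoords x = (whiten x, (sampleFrame hnd x hx).coords) := rfl

theorem mapsTo_whitenCoords (hnd : d < n) :
    MapsTo whitenCoords {x : Fin n → EuclideanSpace ℝ (Fin d) | InGeneralPosition x}
      (whitened d n ×ˢ range (GN.coords (d := d))) :=
  fun x hx => ⟨whiten_mem_whitened hnd x hx, sampleFrame hnd x hx, rfl⟩

theorem mapsTo_unwhiten :
    MapsTo unwhiten (whitened d n ×ˢ range (GN.coords (d := d)))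
      {x : Fin n → EuclideanSpace ℝ (Fin d) | InGeneralPosition x} := by
  rintro ⟨y, _⟩ ⟨hy, g, rfl⟩
  exact (inGeneralPosition_smul_iff g y).2 hy.1

theorem whitenCoords_smul (hnd : d < n) {y : Fin n → EuclideanSpace ℝ (Fin d)}
    (hy : y ∈ whitened d n) (g : GN d) : whitenCoords (g • y) = (y, g.coords) := by
  have hgy : InGeneralPosition (g • y) := (inGeneralPosition_smul_iff g y).2 hy.1
  rw [whitenCoords_eq hnd _ hgy, whiten_smul hnd g y hy.1, whiten_of_mem_whitened hnd hy,
    sampleFrame_smul hnd g y hy.1 hgy, sampleFrame_of_mem_whitened hnd hy, mul_one]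

theorem invOn_unwhiten_whitenCoords (hnd : d < n) :
    InvOn unwhiten whitenCoords {x : Fin n → EuclideanSpace ℝ (Fin d) | InGeneralPosition x}
      (whitened d n ×ˢ range (GN.coords (d := d))) := by
  refine ⟨fun x hx => ?_, ?_⟩
  · rw [whitenCoords_eq hnd x hx, unwhiten_coords, sampleFrame_smul_whiten]
  · rintro ⟨y, _⟩ ⟨hy, g, rfl⟩
    rw [unwhiten_coords, whitenCoords_smul hnd hy]

end Sample

/-! ### Smoothness of the Cholesky factor and of whitening -/

section MatrixSmooth

variable {F : Type*} [NormedAddCommGroup F] [NormedSpace ℝ F] {k : WithTop ℕ∞} {x : F} {d : ℕ}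

theorem contDiffAt_matrix_iff {m : ℕ} {A : F → Matrix (Fin d) (Fin m) ℝ} :
    ContDiffAt ℝ k A x ↔ ∀ i j, ContDiffAt ℝ k (fun y => A y i j) x := by
  refine contDiffAt_pi.trans (forall_congr' fun i => ?_)
  exact contDiffAt_pi

theorem ContDiffAt.matrix_det {A : F → Matrix (Fin d) (Fin d) ℝ}
    (hA : ContDiffAt ℝ k A x) : ContDiffAt ℝ k (fun y => (A y).det) x := by
  simp only [Matrix.det_apply']
  refine ContDiffAt.sum fun σ _ => contDiffAt_const.mul (contDiffAt_prod fun i _ => ?_)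
  exact contDiffAt_matrix_iff.1 hA _ _

theorem ContDiffAt.matrix_adjugate {A : F → Matrix (Fin d) (Fin d) ℝ}
    (hA : ContDiffAt ℝ k A x) : ContDiffAt ℝ k (fun y => (A y).adjugate) x := by
  refine contDiffAt_matrix_iff.2 fun i j => ?_
  simp only [Matrix.adjugate_apply]
  refine ContDiffAt.matrix_det (contDiffAt_matrix_iff.2 fun a b => ?_)
  simp only [Matrix.updateRow_apply]
  split_ifs
  · exact contDiffAt_const
  · exact contDiffAt_matrix_iff.1 hA _ _

theorem ContDiffAt.matrix_inv {A : F → Matrix (Fin d) (Fin d) ℝ}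
    (hA : ContDiffAt ℝ k A x) (h : IsUnit (A x).det) :
    ContDiffAt ℝ k (fun y => (A y)⁻¹) x := by
  simp only [Matrix.inv_def, Ring.inverse_eq_inv']
  exact (hA.matrix_det.inv h.ne_zero).smul hA.matrix_adjugate

theorem ContDiffAt.gn_act {A : F → Matrix (Fin d) (Fin d) ℝ} {v : F → EuclideanSpace ℝ (Fin d)}
    (hA : ContDiffAt ℝ k A x) (hv : ContDiffAt ℝ k v x) :
    ContDiffAt ℝ k (fun y => GN.act (A y) (v y)) x := by
  refine contDiffAt_euclidean.2 fun i => ?_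
  simp only [GN.act, Matrix.mulVec, dotProduct]
  exact ContDiffAt.sum fun j _ =>
    (contDiffAt_matrix_iff.1 hA i j).mul (contDiffAt_euclidean.1 hv j)

end MatrixSmooth

/-- The upper triangular part of `A Aᵀ`, completed by the strictly lower triangular part of `A`. -/
noncomputable def upperGram {d : ℕ} (A : Matrix (Fin d) (Fin d) ℝ) : Matrix (Fin d) (Fin d) ℝ :=
  Matrix.of fun i j => if i ≤ j then (A * Aᵀ) i j else A i j

section UpperGram

variable {d : ℕ}

theorem contDiff_upperGram : ContDiff ℝ ∞ (upperGram (d := d)) := by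
  refine contDiff_iff_contDiffAt.2 fun A => contDiffAt_matrix_iff.2 fun i j => ?_
  have h : ∀ i j, ContDiffAt ℝ ∞ (fun y : Matrix (Fin d) (Fin d) ℝ => y i j) A := fun i j =>
    contDiffAt_matrix_iff.1 contDiffAt_id i j
  simp only [upperGram, Matrix.of_apply, Matrix.mul_apply, Matrix.transpose_apply]
  split_ifs
  · exact ContDiffAt.sum fun k _ => (h _ _).mul (h _ _)
  · exact h _ _

theorem fderiv_upperGram_apply (U H : Matrix (Fin d) (Fin d) ℝ) (i j : Fin d) :
    (fderiv ℝ upperGram U H : Matrix (Fin d) (Fin d) ℝ) i j =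
      if i ≤ j then (H * Uᵀ + U * Hᵀ) i j else H i j := by
  have hq : HasFDerivAt upperGram (fderiv ℝ upperGram U) (U + (0 : ℝ) • H) := by
    rw [zero_smul, add_zero]
    exact (contDiff_upperGram.differentiable (by simp)).differentiableAt.hasFDerivAt
  have hl : HasDerivAt (fun t : ℝ => U + t • H) H 0 := by
    have := ((hasDerivAt_id (0 : ℝ)).smul_const H).const_add U
    rwa [one_smul] at this
  have h1 := hq.comp_hasDerivAt (0 : ℝ) hl
  have h2 : HasDerivAt (fun t : ℝ => upperGram (U + t • H) i j)
      ((fderiv ℝ upperGram U H : Matrix (Fin d) (Fin d) ℝ) i j) 0 :=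
    (hasDerivAt_pi.1 (hasDerivAt_pi.1 h1 i) j)
  refine h2.unique ?_
  have he : ∀ a b, HasDerivAt (fun t : ℝ => (U + t • H) a b) (H a b) 0 := fun a b =>
    (hasDerivAt_pi.1 (hasDerivAt_pi.1 hl a) b)
  simp only [upperGram, Matrix.of_apply]
  split_ifs
  · simp only [Matrix.mul_apply, Matrix.transpose_apply, Matrix.add_apply,
      ← Finset.sum_add_distrib]
    have := HasDerivAt.fun_sum (u := Finset.univ) fun k _ => (he i k).mul (he j k)
    simpa using this
  · exact he i j

/-- The map A ↦ AAᵀ on all matrices cannot be a local diffeomorphism, since its values are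
symmetric. Recording the lower entries of A in the redundant half repairs this: an H in the kernel
is upper triangular and satisfies HUᵀ + UHᵀ = 0. -/
theorem fderiv_upperGram_injective {U : Matrix (Fin d) (Fin d) ℝ} (hU : IsUpperPos U) :
    Function.Injective (fderiv ℝ upperGram U) := by
  refine (injective_iff_map_eq_zero _).2 fun H hH => ?_
  have h0 : ∀ i j, (if i ≤ j then (H * Uᵀ + U * Hᵀ) i j else H i j) = 0 := fun i j => by
    rw [← fderiv_upperGram_apply, hH]; rfl
  have hup : H.BlockTriangular id := fun i j hij => by
    simpa [not_le.2 (show j < i from hij)] using h0 i j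
  have hsymm : (H * Uᵀ + U * Hᵀ)ᵀ = H * Uᵀ + U * Hᵀ := by
    simp [Matrix.transpose_mul, add_comm]
  have hsum : H * Uᵀ + U * Hᵀ = 0 := by
    ext i j
    rcases le_total i j with hij | hij
    · simpa [hij] using h0 i j
    · rw [← hsymm, Matrix.transpose_apply]
      simpa [hij] using h0 j i
  have hUT : IsUnit Uᵀ.det := by rw [Matrix.det_transpose]; exact hU.isUnit_det
  have h1 : U⁻¹ * H = 0 := by
    refine (hU.inv.1.mul hup).eq_zero_of_add_transpose ?_
    -- Conjugation turns the relation into U⁻¹H + (U⁻¹H)ᵀ = 0 with U⁻¹H upper triangular.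
    have h2 : U⁻¹ * (H * Uᵀ + U * Hᵀ) * (Uᵀ)⁻¹ = 0 := by rw [hsum]; simp
    rw [← h2, Matrix.mul_add, Matrix.add_mul, ← Matrix.mul_assoc, ← Matrix.mul_assoc,
      Matrix.nonsing_inv_mul _ hU.isUnit_det, Matrix.one_mul, Matrix.mul_assoc,
      Matrix.mul_nonsing_inv _ hUT, Matrix.mul_one, Matrix.transpose_mul,
      Matrix.transpose_nonsing_inv]
  calc H = U * (U⁻¹ * H) := by
        rw [← Matrix.mul_assoc, Matrix.mul_nonsing_inv _ hU.isUnit_det, Matrix.one_mul]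
    _ = 0 := by rw [h1, Matrix.mul_zero]

/-- The Cholesky factor depends smoothly on the symmetric positive definite matrix. -/
theorem contDiffAt_upperCholesky_comp {F : Type*} [NormedAddCommGroup F] [NormedSpace ℝ F] {x : F}
    {S : F → Matrix (Fin d) (Fin d) ℝ} (hS : ContDiffAt ℝ ∞ S x) (hsymm : ∀ y, (S y)ᵀ = S y)
    (hpos : (S x).PosDef) : ContDiffAt ℝ ∞ (fun y => upperCholesky (S y)) x := by
  set U := upperCholesky (S x)
  have hU : IsUpperPos U := isUpperPos_upperCholesky hpos
  have hUS : U * Uᵀ = S x := upperCholesky_mul_transpose hpos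
  let f' : Matrix (Fin d) (Fin d) ℝ ≃L[ℝ] Matrix (Fin d) (Fin d) ℝ :=
    (LinearEquiv.ofInjectiveEndo (fderiv ℝ upperGram U : _ →ₗ[ℝ] _)
      (fderiv_upperGram_injective hU)).toContinuousLinearEquiv
  have hf' : HasFDerivAt upperGram (f' : Matrix (Fin d) (Fin d) ℝ →L[ℝ] _) U := by
    have h1 : (f' : Matrix (Fin d) (Fin d) ℝ →L[ℝ] _) = fderiv ℝ upperGram U := by
      ext1 H; rfl
    rw [h1]
    exact (contDiff_upperGram.differentiable (by simp)).differentiableAt.hasFDerivAt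
  have hq : ContDiffAt ℝ ∞ upperGram U := contDiff_upperGram.contDiffAt
  let e := hq.toOpenPartialHomeomorph upperGram hf' (by simp)
  have hUe : U ∈ e.source := hq.mem_toOpenPartialHomeomorph_source hf' (by simp)
  have hesymm : ContDiffAt ℝ ∞ e.symm (upperGram U) := hq.to_localInverse hf' (by simp)
  -- The value that `upperGram` takes at an upper triangular matrix with Gram matrix S y; the zeros
  -- below the diagonal force its local preimage to be upper triangular.
  let T : F → Matrix (Fin d) (Fin d) ℝ := fun y => Matrix.of fun i j => if i ≤ j then S y i j else 0
  have hT : ContDiffAt ℝ ∞ T x := contDiffAt_matrix_iff.2 fun i j => by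
    simp only [T, Matrix.of_apply]
    split_ifs
    · exact contDiffAt_matrix_iff.1 hS i j
    · exact contDiffAt_const
  have hTx : T x = upperGram U := by
    ext i j
    simp only [T, upperGram, Matrix.of_apply, hUS]
    split_ifs with hij
    · rfl
    · exact (hU.1 (show id j < id i from not_le.1 hij)).symm
  have hg : ContDiffAt ℝ ∞ (fun y => e.symm (T y)) x := by
    refine ContDiffAt.comp x ?_ hT
    rw [hTx]
    exact hesymm
  refine hg.congr_of_eventuallyEq ?_
  have hgx : e.symm (T x) = U := by rw [hTx]; exact e.left_inv hUe
  -- Positivity of the diagonal is an open condition, so near x the local preimage is the Cholesky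
  -- factor itself.
  have hdiag : ∀ᶠ y in 𝓝 x, ∀ i, 0 < e.symm (T y) i i := by
    refine Filter.eventually_all.2 fun i => ?_
    have hc : ContinuousAt (fun y => e.symm (T y) i i) x :=
      (contDiffAt_matrix_iff.1 hg i i).continuousAt
    refine hc.eventually_const_lt ?_
    have h : e.symm (T x) i i = U i i := by rw [hgx]
    exact (hU.2 i).trans_eq h.symm
  have htar : ∀ᶠ y in 𝓝 x, T y ∈ e.target := by
    refine hT.continuousAt.eventually_mem (e.open_target.mem_nhds ?_)
    rw [hTx]
    exact e.map_source hUe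
  filter_upwards [hdiag, htar] with y hy1 hy2
  have hr : upperGram (e.symm (T y)) = T y := e.right_inv hy2
  have hij : ∀ i j, upperGram (e.symm (T y)) i j = T y i j := fun i j => by rw [hr]
  simp only [upperGram, T, Matrix.of_apply] at hij
  refine upperCholesky_eq ⟨fun i j h => ?_, hy1⟩ ?_
  · simpa [not_le.2 (show j < i from h)] using hij i j
  · ext i j
    rcases le_total i j with h | h
    · simpa [h] using hij i j
    · have h1 := hij j i
      simp only [h, if_true] at h1
      rw [← hsymm y, Matrix.transpose_apply, ← h1, ← Matrix.transpose_apply (_ * _),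
        Matrix.transpose_mul, Matrix.transpose_transpose]

end UpperGram

/-! ### Smoothness of the sample statistics and the diffeomorphism onto N × G -/

section SampleSmooth

variable {d n : ℕ}

theorem isOpen_inGeneralPosition :
    IsOpen {x : Fin n → EuclideanSpace ℝ (Fin d) | InGeneralPosition x} := by
  have h : {x : Fin n → EuclideanSpace ℝ (Fin d) | InGeneralPosition x} =
      ⋂ s : Finset (Fin n), ⋂ _ : s.card = d + 1,
        (fun x (i : s) => x i) ⁻¹' {p : s → EuclideanSpace ℝ (Fin d) | AffineIndependent ℝ p} := by
    ext x
    simp [InGeneralPosition]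
  rw [h]
  exact isOpen_iInter_of_finite fun s => isOpen_iInter_of_finite fun _ =>
    isOpen_setOfPred_affineIndependent.preimage (by fun_prop)

theorem contDiff_sampleMean : ContDiff ℝ ∞ (sampleMean (d := d) (n := n)) := by
  unfold sampleMean
  fun_prop

theorem contDiff_sampleCov : ContDiff ℝ ∞ (sampleCov (d := d) (n := n)) := by
  refine contDiff_iff_contDiffAt.2 fun x => ?_
  unfold sampleCov
  refine ContDiffAt.const_smul _ (ContDiffAt.sum fun i _ => contDiffAt_matrix_iff.2 fun a b => ?_)
  have h : ∀ a, ContDiffAt ℝ ∞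
      (fun x : Fin n → EuclideanSpace ℝ (Fin d) => (x i - sampleMean x).ofLp a) x := fun a =>
    contDiffAt_euclidean.1 ((contDiff_apply ℝ _ i).contDiffAt.sub contDiff_sampleMean.contDiffAt) a
  simp only [Matrix.vecMulVec_apply]
  exact (h a).mul (h b)

theorem InGeneralPosition.contDiffAt_upperCholesky (hnd : d < n)
    {x : Fin n → EuclideanSpace ℝ (Fin d)} (hx : InGeneralPosition x) :
    ContDiffAt ℝ ∞ (fun y : Fin n → EuclideanSpace ℝ (Fin d) => upperCholesky (sampleCov y)) x :=
  contDiffAt_upperCholesky_comp contDiff_sampleCov.contDiffAt sampleCov_transpose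
    (hx.posDef_sampleCov hnd)

theorem InGeneralPosition.contDiffAt_whiten (hnd : d < n)
    {x : Fin n → EuclideanSpace ℝ (Fin d)} (hx : InGeneralPosition x) :
    ContDiffAt ℝ ∞ whiten x := by
  refine contDiffAt_pi.2 fun i => ContDiffAt.gn_act ?_ ?_
  · exact (hx.contDiffAt_upperCholesky hnd).matrix_inv
      (isUpperPos_upperCholesky (hx.posDef_sampleCov hnd)).isUnit_det
  · exact (contDiff_apply ℝ _ i).contDiffAt.sub contDiff_sampleMean.contDiffAt

theorem InGeneralPosition.contDiffAt_whitenCoords (hnd : d < n)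
    {x : Fin n → EuclideanSpace ℝ (Fin d)} (hx : InGeneralPosition x) :
    ContDiffAt ℝ ∞ whitenCoords x :=
  (hx.contDiffAt_whiten hnd).prodMk
    ((hx.contDiffAt_upperCholesky hnd).prodMk contDiff_sampleMean.contDiffAt)

theorem contDiff_unwhiten : ContDiff ℝ ∞ (unwhiten (d := d) (n := n)) := by
  refine contDiff_iff_contDiffAt.2 fun p => contDiffAt_pi.2 fun i => ContDiffAt.add ?_ ?_
  · exact ContDiffAt.gn_act (contDiff_fst.comp contDiff_snd).contDiffAt
      ((contDiff_apply ℝ _ i).comp contDiff_fst).contDiffAt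
  · exact (contDiff_snd.comp contDiff_snd).contDiffAt

theorem isDiffeoOn_whitenCoords (hnd : d < n) :
    IsDiffeoOn whitenCoords unwhiten
      {x : Fin n → EuclideanSpace ℝ (Fin d) | InGeneralPosition x}
      (whitened d n ×ˢ range (GN.coords (d := d))) where
  mapsTo := mapsTo_whitenCoords hnd
  mapsTo_inv := mapsTo_unwhiten
  invOn := invOn_unwhiten_whitenCoords hnd
  smoothOn _ hx := ⟨_, whitenCoords, isOpen_inGeneralPosition, hx,
    fun _ hy => (InGeneralPosition.contDiffAt_whitenCoords hnd hy).contDiffWithinAt,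
    fun _ _ => rfl⟩
  smoothOn_inv _ _ := ⟨univ, unwhiten, isOpen_univ, mem_univ _, contDiff_unwhiten.contDiffOn,
    fun _ _ => rfl⟩

end SampleSmooth

/-! ### Images of smooth retractions are submanifolds -/

section Retraction

variable {E : Type*} [NormedAddCommGroup E] [NormedSpace ℝ E] [FiniteDimensional ℝ E]

/-- The set of fixed points of a smooth retraction of an open set is a submanifold. -/
theorem isSmoothSubmanifold_of_retraction {w : E → E} {U N : Set E} {k : ℕ} (hU : IsOpen U)
    (hw : ∀ x ∈ U, ContDiffAt ℝ ∞ w x) (hN : N ⊆ U) (hmaps : MapsTo w U N)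
    (hfix : ∀ y ∈ N, w y = y) (hk : ∀ x ∈ N, Module.finrank ℝ (fderiv ℝ w x).range = k) :
    IsSmoothSubmanifold k N := by
  intro x hx
  have hxU := hN hx
  have hwx := hfix x hx
  set P := fderiv ℝ w x with hP
  have hwd : HasFDerivAt w P x := ((hw x hxU).differentiableAt (by simp)).hasFDerivAt
  -- Differentiate w ∘ w = w at the fixed point x.
  have hPP : P.comp P = P := by
    have h1 : HasFDerivAt (w ∘ w) (P.comp P) x := by
      refine HasFDerivAt.comp x ?_ hwd
      rwa [hwx]
    refine h1.unique (hwd.congr_of_eventuallyEq ?_)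
    filter_upwards [hU.mem_nhds hxU] with y hy
    exact hfix _ (hmaps hy)
  have hPP' : ∀ v, P (P v) = P v := fun v => congrArg (fun A : E →L[ℝ] E => A v) hPP
  -- Straightening chart: position along N in the range of P, displacement y - w(y) in its
  -- complement. Its derivative at x is P² + (1-P)² = 1.
  let φ : E → E := fun y => P (w y - x) + ((y - w y) - P (y - w y))
  have hφ : ∀ y ∈ U, ContDiffAt ℝ ∞ φ y := fun y hy => by
    have h1 := hw y hy
    exact (P.contDiff.contDiffAt.comp y (h1.sub contDiffAt_const)).add
      ((contDiffAt_id.sub h1).sub (P.contDiff.contDiffAt.comp y (contDiffAt_id.sub h1)))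
  have hφ' : HasFDerivAt φ (ContinuousLinearEquiv.refl ℝ E : E →L[ℝ] E) x := by
    have h1 : HasFDerivAt (fun y => y - w y) (ContinuousLinearMap.id ℝ E - P) x :=
      (hasFDerivAt_id x).sub hwd
    have h2 := (P.hasFDerivAt.comp x (hwd.sub_const x)).add (h1.sub (P.hasFDerivAt.comp x h1))
    refine h2.congr_fderiv ?_
    ext v
    simp [hPP']
  let e := (hφ x hxU).toOpenPartialHomeomorph φ hφ' (by simp)
  have hxe : x ∈ e.source := (hφ x hxU).mem_toOpenPartialHomeomorph_source hφ' (by simp)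
  have hφU : ContDiffOn ℝ ∞ φ U := fun y hy => (hφ y hy).contDiffWithinAt
  have hwc : ContinuousOn w U := fun y hy => (hw y hy).continuousAt.continuousWithinAt
  -- On A the derivative of φ is invertible, which makes the inverse smooth on the whole target. On
  -- B the point w(y) stays in the source, so that injectivity can compare y with w(y).
  let A : Set E := U ∩ fderiv ℝ φ ⁻¹' range ((↑) : (E ≃L[ℝ] E) → E →L[ℝ] E)
  have hA : IsOpen A :=
    (hφU.continuousOn_fderiv_of_isOpen hU (by simp)).isOpen_inter_preimage hU
      ContinuousLinearEquiv.isOpen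
  let B : Set E := U ∩ w ⁻¹' e.source
  have hB : IsOpen B := hwc.isOpen_inter_preimage hU e.open_source
  have hxAB : x ∈ A ∩ B :=
    ⟨⟨hxU, ContinuousLinearEquiv.refl ℝ E, hφ'.fderiv.symm⟩, hxU, by rwa [mem_preimage, hwx]⟩
  let e' := e.restrOpen (A ∩ B) (hA.inter hB)
  have hsub : ∀ y ∈ e'.source, y ∈ e.source ∧ y ∈ A ∧ y ∈ B := fun y hy => by
    rwa [OpenPartialHomeomorph.restrOpen_source] at hy
  have hcoe : ∀ y, e' y = φ y := fun y => rfl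
  refine ⟨e', P.range, ?_, ?_, ?_, hk x hx, ?_⟩
  · rw [OpenPartialHomeomorph.restrOpen_source]
    exact ⟨hxe, hxAB⟩
  · exact hφU.mono fun y hy => (hsub y hy).2.1.1
  · intro z hz
    have hz' := hsub _ (e'.map_target hz)
    obtain ⟨f', hf'⟩ := hz'.2.1.2
    have hcd : ContDiffAt ℝ ∞ φ (e'.symm z) := hφ _ hz'.2.1.1
    refine (e'.contDiffAt_symm (f₀' := f') hz ?_ hcd).contDiffWithinAt
    rw [hf']
    exact (hcd.differentiableAt (by simp)).hasFDerivAt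
  · intro y hy
    obtain ⟨hye, hyA, hyB⟩ := hsub y hy
    rw [hcoe]
    constructor
    · intro hyN
      refine ⟨y - x, ?_⟩
      simp [φ, hfix y hyN]
    · rintro ⟨z, hz⟩
      have h1 : (y - w y) - P (y - w y) = P (z - (w y - x)) := by
        rw [map_sub P z]
        exact eq_sub_of_add_eq' hz.symm
      -- This vector is killed by P and lies in the range of the projection P, so it vanishes. Then
      -- φ(y) = φ(w(y)), and y = w(y) by injectivity.
      have h2 : (y - w y) - P (y - w y) = 0 := by
        have h3 := congrArg P h1
        rw [map_sub, hPP', sub_self, hPP'] at h3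
        rw [h1, ← h3]
      have hwN := hmaps hyA.1
      have h4 : φ y = φ (w y) := by
        simp only [φ, hfix _ hwN, h2, sub_self, map_zero]
      have h5 : y = w y := e.injOn hye hyB.2 h4
      rw [h5]
      exact hwN

end Retraction

/-! ### The rank of the whitening map -/

/-- Upper triangular matrices. -/
def upperTriangular (d : ℕ) : Submodule ℝ (Matrix (Fin d) (Fin d) ℝ) where
  carrier := {A | A.BlockTriangular id}
  add_mem' hA hB := hA.add hB
  zero_mem' := Matrix.blockTriangular_zero
  smul_mem' c A hA i j hij := by rw [Matrix.smul_apply, hA hij, smul_zero]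

/-- An upper triangular matrix is determined by its entries on and above the diagonal. -/
def upperTriangularEquiv (d : ℕ) :
    upperTriangular d ≃ₗ[ℝ] ({p : Fin d × Fin d // p.1 ≤ p.2} → ℝ) where
  toFun A p := A.1 p.1.1 p.1.2
  invFun f := ⟨Matrix.of fun i j => if h : i ≤ j then f ⟨(i, j), h⟩ else 0,
    fun i j hij => by simp [not_le.2 (show j < i from hij)]⟩
  map_add' _ _ := rfl
  map_smul' _ _ := rfl
  left_inv A := by
    ext i j
    simp only [Matrix.of_apply]
    split_ifs with h
    · rfl
    · exact (A.2 (show id j < id i from not_le.1 h)).symm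
  right_inv f := by
    funext p
    simp [p.2]

theorem finrank_upperTriangular (d : ℕ) :
    Module.finrank ℝ (upperTriangular d) = d * (d + 1) / 2 := by
  rw [(upperTriangularEquiv d).finrank_eq, Module.finrank_fintype_fun_eq_card,
    -- Ordered pairs i ≤ j correspond to unordered pairs with repetition.
    ← Fintype.card_congr Sym2.sortEquiv, Sym2.card, Fintype.card_fin, Nat.choose_two_right,
    Nat.add_sub_cancel, mul_comm]

section Rank

variable {d n : ℕ}

/-- The linear map `(V, m) ↦ (V yᵢ + m)ᵢ` on pairs of an upper triangular matrix and a vector. -/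
noncomputable def orbitTangent (y : Fin n → EuclideanSpace ℝ (Fin d)) :
    upperTriangular d × EuclideanSpace ℝ (Fin d) →ₗ[ℝ] (Fin n → EuclideanSpace ℝ (Fin d)) where
  toFun p := unwhiten (y, (p.1.1, p.2))
  map_add' p q := by
    funext i
    simp only [unwhiten, Prod.fst_add, Prod.snd_add, Submodule.coe_add, Pi.add_apply,
      GN.act_eq_toLpLin, map_add, LinearMap.add_apply]
    abel
  map_smul' c p := by
    funext i
    simp only [unwhiten, Prod.smul_fst, Prod.smul_snd, Submodule.coe_smul, Pi.smul_apply,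
      GN.act_eq_toLpLin, map_smul, LinearMap.smul_apply, smul_add, RingHom.id_apply]

/-- Averaging over i kills the matrix term because y has mean zero, so m = 0. Then V annihilates
every yᵢ, hence V = V · `sampleCov y` = 0. -/
theorem orbitTangent_injective (hn : n ≠ 0) {y : Fin n → EuclideanSpace ℝ (Fin d)}
    (hy : y ∈ whitened d n) : Function.Injective (orbitTangent y) := by
  refine (injective_iff_map_eq_zero _).2 fun p hp => ?_
  have hn' : (n : ℝ) ≠ 0 := Nat.cast_ne_zero.2 hn
  have h : ∀ i, GN.act p.1.1 (y i) + p.2 = 0 := fun i => congrFun hp i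
  have hm : p.2 = 0 := by
    have h1 : (1 / (n : ℝ)) • ∑ i, (GN.act p.1.1 (y i) + p.2) = 0 := by simp [h]
    rw [Finset.sum_add_distrib, ← GN.act_sum, smul_add, ← GN.act_smul] at h1
    have h2 : (1 / (n : ℝ)) • ∑ i, y i = 0 := hy.2.1
    rw [h2, Finset.sum_const, Finset.card_univ, Fintype.card_fin, ← Nat.cast_smul_eq_nsmul ℝ,
      smul_smul, one_div_mul_cancel hn', one_smul, GN.act_eq_toLpLin, map_zero, zero_add] at h1
    exact h1
  have hV : p.1.1 = 0 := by
    have h1 : p.1.1 * sampleCov y = 0 := by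
      rw [sampleCov, hy.2.1, Matrix.mul_smul, Matrix.mul_sum, Finset.sum_eq_zero, smul_zero]
      intro i _
      have h2 : p.1.1 *ᵥ (y i).ofLp = 0 := by
        have h3 := h i
        rw [hm, add_zero] at h3
        exact congrArg WithLp.ofLp h3
      rw [sub_zero, Matrix.mul_vecMulVec, h2, Matrix.zero_vecMulVec]
    rwa [hy.2.2, Matrix.mul_one] at h1
  exact Prod.ext (Subtype.ext hV) hm

/-- With x = g · w(x), the line x + t(Vwᵢ + m)ᵢ equals (g + t(V, m)) · w(x). For small t the
diagonal stays positive, so the line remains in the orbit, where w is constant. -/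
theorem InGeneralPosition.fderiv_whiten_orbitTangent (hnd : d < n)
    {x : Fin n → EuclideanSpace ℝ (Fin d)} (hx : InGeneralPosition x)
    (p : upperTriangular d × EuclideanSpace ℝ (Fin d)) :
    fderiv ℝ whiten x (orbitTangent (whiten x) p) = 0 := by
  set g := sampleFrame hnd x hx
  have hwx := whiten_mem_whitened hnd x hx
  have hw : HasFDerivAt whiten (fderiv ℝ whiten x)
      (x + (0 : ℝ) • orbitTangent (whiten x) p) := by
    rw [zero_smul, add_zero]
    exact ((hx.contDiffAt_whiten hnd).differentiableAt (by simp)).hasFDerivAt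
  have hl : HasDerivAt (fun t : ℝ => x + t • orbitTangent (whiten x) p)
      (orbitTangent (whiten x) p) 0 := by
    have := ((hasDerivAt_id (0 : ℝ)).smul_const (orbitTangent (whiten x) p)).const_add x
    rwa [one_smul] at this
  refine (hw.comp_hasDerivAt (0 : ℝ) hl).unique
    ((hasDerivAt_const (0 : ℝ) (whiten x)).congr_of_eventuallyEq ?_)
  have hpos : ∀ᶠ t : ℝ in 𝓝 0, ∀ i, 0 < g.V i i + t * p.1.1 i i := by
    refine Filter.eventually_all.2 fun i => ?_
    have hc : ContinuousAt (fun t : ℝ => g.V i i + t * p.1.1 i i) 0 := by fun_prop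
    refine hc.eventually_const_lt ?_
    have h : g.V i i + 0 * p.1.1 i i = g.V i i := by rw [zero_mul, add_zero]
    exact (g.isUpperPos.2 i).trans_eq h.symm
  filter_upwards [hpos] with t ht
  let gt : GN d := ⟨g.V + t • p.1.1, g.m + t • p.2,
    ⟨g.isUpperPos.1.add ((upperTriangular d).smul_mem t p.1.2), ht⟩⟩
  have hxt : x + t • orbitTangent (whiten x) p = gt • whiten x := by
    have h1 : x = orbitTangent (whiten x) (⟨g.V, g.isUpperPos.1⟩, g.m) :=
      (sampleFrame_smul_whiten hnd x hx).symm
    calc x + t • orbitTangent (whiten x) p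
        = orbitTangent (whiten x) (⟨g.V, g.isUpperPos.1⟩, g.m) + t • orbitTangent (whiten x) p :=
          congrArg (· + t • orbitTangent (whiten x) p) h1
      _ = orbitTangent (whiten x) ((⟨g.V, g.isUpperPos.1⟩, g.m) + t • p) := by
          rw [map_add, map_smul]
      _ = gt • whiten x := rfl
  rw [Function.comp_apply, hxt, whiten_smul hnd gt _ hwx.1, whiten_of_mem_whitened hnd hwx]

/-- Upper bound: on the kernel of dw, a vector is determined by the derivatives of the Cholesky
factor and of the mean. Lower bound: the orbit directions inject into the kernel. -/
theorem InGeneralPosition.finrank_ker_fderiv_whiten (hnd : d < n)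
    {x : Fin n → EuclideanSpace ℝ (Fin d)} (hx : InGeneralPosition x) :
    Module.finrank ℝ (fderiv ℝ whiten x).ker = d * (d + 1) / 2 + d := by
  have hdim : Module.finrank ℝ (upperTriangular d × EuclideanSpace ℝ (Fin d)) =
      d * (d + 1) / 2 + d := by
    rw [Module.finrank_prod, finrank_upperTriangular, finrank_euclideanSpace, Fintype.card_fin]
  refine le_antisymm ?_ ?_
  · obtain ⟨C', hC⟩ : ∃ C' : (Fin n → EuclideanSpace ℝ (Fin d)) →L[ℝ] Matrix (Fin d) (Fin d) ℝ,
        HasFDerivAt (fun y => upperCholesky (sampleCov y)) C' x :=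
      ⟨_, ((hx.contDiffAt_upperCholesky hnd).differentiableAt (by simp)).hasFDerivAt⟩
    obtain ⟨M', hM⟩ : ∃ M', HasFDerivAt (sampleMean (d := d) (n := n)) M' x :=
      ⟨_, (contDiff_sampleMean.differentiable (by simp)).differentiableAt.hasFDerivAt⟩
    have hw : HasFDerivAt whiten (fderiv ℝ whiten x) x :=
      ((hx.contDiffAt_whiten hnd).differentiableAt (by simp)).hasFDerivAt
    -- Entries of the Cholesky factor below the diagonal vanish identically near x, so their
    -- derivatives vanish.
    have hup : ∀ v, C' v ∈ upperTriangular d := fun v i j hij => by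
      let ev : Matrix (Fin d) (Fin d) ℝ →L[ℝ] ℝ :=
        (Matrix.entryLinearMap ℝ ℝ i j).toContinuousLinearMap
      have h1 : HasFDerivAt (fun y : Fin n → EuclideanSpace ℝ (Fin d) =>
          upperCholesky (sampleCov y) i j) (ev.comp C') x := ev.hasFDerivAt.comp x hC
      have h2 : HasFDerivAt (fun y : Fin n → EuclideanSpace ℝ (Fin d) =>
          upperCholesky (sampleCov y) i j)
          (0 : (Fin n → EuclideanSpace ℝ (Fin d)) →L[ℝ] ℝ) x := by
        refine (hasFDerivAt_const (0 : ℝ) x).congr_of_eventuallyEq ?_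
        filter_upwards [isOpen_inGeneralPosition.mem_nhds hx] with y hy
        exact (isUpperPos_upperCholesky (InGeneralPosition.posDef_sampleCov hnd hy)).1 hij
      exact congrArg (fun A : (Fin n → EuclideanSpace ℝ (Fin d)) →L[ℝ] ℝ => A v) (h1.unique h2)
    let L : (Fin n → EuclideanSpace ℝ (Fin d)) →ₗ[ℝ]
        upperTriangular d × EuclideanSpace ℝ (Fin d) :=
      (LinearMap.codRestrict (upperTriangular d) (C' : _ →ₗ[ℝ] _) hup).prod (M' : _ →ₗ[ℝ] _)
    rw [← hdim]
    refine LinearMap.finrank_le_finrank_of_injective (f := L.domRestrict (fderiv ℝ whiten x).ker)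
      ((injective_iff_map_eq_zero _).2 fun v hv => Subtype.ext ?_)
    have hwv : fderiv ℝ whiten x v = 0 := v.2
    have hCv : C' v = 0 := congrArg (fun q => q.1.1) hv
    have hMv : M' v = 0 := congrArg (fun q => q.2) hv
    -- Differentiating `unwhiten ∘ whitenCoords = id` recovers v from its three derivative
    -- components, all of which are zero.
    have hinv := ((contDiff_unwhiten (d := d) (n := n)).differentiable
      (by simp)).differentiableAt.hasFDerivAt.comp x (hw.prodMk (hC.prodMk hM))
    have hid := hinv.unique ((hasFDerivAt_id x).congr_of_eventuallyEq (by
      filter_upwards [isOpen_inGeneralPosition.mem_nhds hx] with y hy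
      exact (invOn_unwhiten_whitenCoords hnd).1 hy))
    have hv2 := congrArg (fun A : (Fin n → EuclideanSpace ℝ (Fin d)) →L[ℝ] _ => A v) hid
    have h0 : (fderiv ℝ whiten x).prod (C'.prod M') v.1 = 0 :=
      Prod.ext hwv (Prod.ext hCv hMv)
    exact hv2.symm.trans ((congrArg (fderiv ℝ unwhiten _) h0).trans
      (ContinuousLinearMap.map_zero _))
  · rw [← hdim]
    refine LinearMap.finrank_le_finrank_of_injective
      (f := (orbitTangent (whiten x)).codRestrict (fderiv ℝ whiten x).ker
        (hx.fderiv_whiten_orbitTangent hnd)) ?_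
    exact fun a b hab => orbitTangent_injective (by omega) (whiten_mem_whitened hnd x hx)
      (congrArg Subtype.val hab)

/-- Rank-nullity; it also shows that the natural-number subtraction does not truncate. -/
theorem InGeneralPosition.finrank_range_fderiv_whiten (hnd : d < n)
    {x : Fin n → EuclideanSpace ℝ (Fin d)} (hx : InGeneralPosition x) :
    Module.finrank ℝ (fderiv ℝ whiten x).range = n * d - (d + d * (d + 1) / 2) := by
  have h := LinearMap.finrank_range_add_finrank_ker (fderiv ℝ whiten x).toLinearMap
  have h2 : Module.finrank ℝ (Fin n → EuclideanSpace ℝ (Fin d)) = n * d := by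
    simp [Module.finrank_pi_fintype]
  have h3 := hx.finrank_ker_fderiv_whiten hnd
  rw [h2, h3] at h
  omega

theorem isSmoothSubmanifold_whitened (hnd : d < n) :
    IsSmoothSubmanifold (n * d - (d + d * (d + 1) / 2)) (whitened d n) :=
  isSmoothSubmanifold_of_retraction isOpen_inGeneralPosition
    (fun _ hx => InGeneralPosition.contDiffAt_whiten hnd hx) (fun _ hx => hx.1)
    (fun x hx => whiten_mem_whitened hnd x hx) (fun _ hy => whiten_of_mem_whitened hnd hy)
    (fun _ hx => hx.1.finrank_range_fderiv_whiten hnd)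

end Rank

/-! ### Disintegration of quasi-invariant measures -/

section Disintegration

variable {G Y : Type*} [Group G] [MeasurableSpace G] [MeasurableMul₂ G] [MeasurableInv G]
  [MeasurableSpace Y]

/-- A measure on `Y × G` that is quasi-invariant under left translation of the second factor has
the same null sets as the product of its first marginal with a left-invariant measure. -/
theorem measure_null_iff_fst_prod_null (l : Measure G) [SigmaFinite l] [l.IsMulLeftInvariant]
    [NeZero l] (ρ : Measure (Y × G)) [IsFiniteMeasure ρ]
    (hq : ∀ g : G, ρ.map (fun p => (p.1, g * p.2)) ≪ ρ) {A : Set (Y × G)} (hA : MeasurableSet A) :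
    ρ A = 0 ↔ (ρ.fst.prod l) A = 0 := by
  have hT : ∀ g : G, Measurable fun p : Y × G => (p.1, g * p.2) := fun g => by fun_prop
  have hT' : ∀ g : G, ∀ B : Set (Y × G), MeasurableSet B → ρ B = 0 →
      ρ ((fun p => (p.1, g * p.2)) ⁻¹' B) = 0 := fun g B hB h => by
    rw [← Measure.map_apply (hT g) hB]
    exact hq g h
  have hm : Measurable fun q : G × (Y × G) => (q.2.1, q.1 * q.2.2) := by fun_prop
  set B : Set (G × (Y × G)) := (fun q => (q.2.1, q.1 * q.2.2)) ⁻¹' A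
  have hB : MeasurableSet B := hm hA
  -- By quasi-invariance under g and g⁻¹, A is null exactly when its preimage under translation by g
  -- is null, for one or for all g; so g may be averaged against l.
  have hstep1 : ρ A = 0 ↔ (l.prod ρ) B = 0 := by
    rw [Measure.measure_prod_null hB]
    constructor
    · exact fun h => Filter.Eventually.of_forall fun g => hT' g A hA h
    · intro h
      obtain ⟨g, hg⟩ := h.exists
      have h1 := hT' g⁻¹ _ (hT g hA) hg
      have h2 : (fun p : Y × G => (p.1, g⁻¹ * p.2)) ⁻¹' ((fun p => (p.1, g * p.2)) ⁻¹' A) = A := by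
        ext p
        simp
      rwa [h2] at h1
  have hmA : MeasurableSet {y | l (Prod.mk y ⁻¹' A) = 0} :=
    measurable_measure_prodMk_left hA (measurableSet_singleton 0)
  rw [hstep1, Measure.measure_prod_null hA, Measure.prod_apply_symm hB,
    lintegral_eq_zero_iff (measurable_measure_prodMk_right hB)]
  have h3 : (∀ᵐ y ∂ρ.fst, l (Prod.mk y ⁻¹' A) = 0) ↔
      ∀ᵐ p ∂ρ, l (Prod.mk p.1 ⁻¹' A) = 0 := ae_map_iff measurable_fst.aemeasurable hmA
  refine Iff.trans (Filter.eventually_congr (Filter.Eventually.of_forall fun p => ?_)) h3.symm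
  -- In the other order of integration, the g-section of B at p is a right translate of a section of
  -- A, and right translation preserves the null sets of a left-invariant measure.
  exact measure_mul_right_null l (s := Prod.mk p.1 ⁻¹' A) p.2

variable [StandardBorelSpace G]

/-- The conditional kernel of a quasi-invariant measure can be chosen such that every fibre
measure has the null sets of the invariant measure. -/
theorem exists_kernel_of_quasiInvariant (l : Measure G) [SigmaFinite l] [l.IsMulLeftInvariant]
    [NeZero l] (ρ : Measure (Y × G)) [IsFiniteMeasure ρ]
    (hq : ∀ g : G, ρ.map (fun p => (p.1, g * p.2)) ≪ ρ) :
    ∃ κ : Kernel Y G, IsFiniteKernel κ ∧ (∀ᵐ y ∂ρ.fst, IsProbabilityMeasure (κ y)) ∧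
      (∀ y, κ y ≪ l ∧ l ≪ κ y) ∧
      ∀ f : Y × G → ℝ≥0∞, Measurable f → ∫⁻ p, f p ∂ρ = ∫⁻ y, ∫⁻ g, f (y, g) ∂κ y ∂ρ.fst := by
  -- Haar measure may be infinite; an equivalent finite measure gives a finite constant kernel.
  set m := l.toFinite
  have hml : m ≪ l := toFinite_absolutelyContinuous l
  have hlm : l ≪ m := absolutelyContinuous_toFinite l
  have hρ : ρ.fst ⊗ₘ ρ.condKernel = ρ := ρ.disintegrate ρ.condKernel
  have hc : ρ.fst ⊗ₘ Kernel.const Y m = ρ.fst.prod m := Measure.compProd_const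
  have h1 : ρ.fst ⊗ₘ ρ.condKernel ≪ ρ.fst ⊗ₘ Kernel.const Y m := by
    rw [hρ, hc]
    refine Measure.AbsolutelyContinuous.trans (Measure.AbsolutelyContinuous.mk fun A hA h => ?_)
      (Measure.AbsolutelyContinuous.rfl.prod hlm)
    exact (measure_null_iff_fst_prod_null l ρ hq hA).2 h
  have h2 : ρ.fst ⊗ₘ Kernel.const Y m ≪ ρ.fst ⊗ₘ ρ.condKernel := by
    rw [hρ, hc]
    refine (Measure.AbsolutelyContinuous.rfl.prod hml).trans
      (Measure.AbsolutelyContinuous.mk fun A hA h => ?_)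
    exact (measure_null_iff_fst_prod_null l ρ hq hA).1 h
  have hS : MeasurableSet ({y | ρ.condKernel y ≪ Kernel.const Y m y} ∩
      {y | Kernel.const Y m y ≪ ρ.condKernel y}) :=
    (Kernel.measurableSet_absolutelyContinuous _ _).inter
      (Kernel.measurableSet_absolutelyContinuous _ _)
  classical
  -- Equivalence with l is required on every fibre. It holds for the conditional kernel on almost
  -- every fibre; on the others the kernel is replaced by m, without affecting the integrals.
  let κ := Kernel.piecewise hS ρ.condKernel (Kernel.const Y m)
  have hae : ∀ᵐ y ∂ρ.fst, κ y = ρ.condKernel y := by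
    filter_upwards [h1.kernel_of_compProd, h2.kernel_of_compProd] with y hy1 hy2
    exact if_pos ⟨hy1, hy2⟩
  refine ⟨κ, inferInstance, ?_, fun y => ?_, fun f hf => ?_⟩
  · filter_upwards [hae] with y hy
    rw [hy]
    infer_instance
  · rw [Kernel.piecewise_apply]
    split_ifs with hy
    · exact ⟨hy.1.trans hml, hlm.trans hy.2⟩
    · exact ⟨hml, hlm⟩
  · conv_lhs => rw [← hρ]
    rw [Measure.lintegral_compProd hf]
    refine lintegral_congr_ae ?_
    filter_upwards [hae] with y hy
    rw [hy]

variable {X : Type*} [MeasurableSpace X] [MulAction G X]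

/-- Disintegration of a quasi-invariant measure along the projection to the first factor of an
equivariant trivialization `X ≃ Y × G`. -/
theorem exists_isDisintegration_of_trivialization [MeasurableSingletonClass Y]
    [MeasurableConstSMul G X] (l : Measure G)
    [SigmaFinite l] [l.IsMulLeftInvariant] [NeZero l] (μ : Measure X) [IsFiniteMeasure μ]
    (hq : ∀ g : G, μ.map (fun x => g • x) ≪ μ) (e : X ≃ᵐ Y × G)
    (he : ∀ (g : G) (x : X), e (g • x) = ((e x).1, g * (e x).2)) :
    ∃ κ : Kernel Y X, IsDisintegration μ (fun x => (e x).1) κ ∧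
      ∀ x : X, κ (e x).1 ≪ l.map (fun g => g • x) ∧ l.map (fun g => g • x) ≪ κ (e x).1 := by
  have hq' : ∀ g : G, (μ.map e).map (fun p => (p.1, g * p.2)) ≪ μ.map e := fun g => by
    have hm : Measurable fun p : Y × G => (p.1, g * p.2) := by fun_prop
    have h1 : (μ.map e).map (fun p => (p.1, g * p.2)) = (μ.map (fun x => g • x)).map e := by
      rw [Measure.map_map hm e.measurable, Measure.map_map e.measurable (measurable_const_smul g)]
      congr 1
      funext x
      exact (he g x).symm
    rw [h1]
    exact (hq g).map e.measurable
  have hfst : (μ.map e).fst = μ.map fun x => (e x).1 := by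
    rw [Measure.fst, Measure.map_map measurable_fst e.measurable]
    rfl
  obtain ⟨κ, hκ, hprob, hac, hint⟩ := exists_kernel_of_quasiInvariant l (μ.map e) hq'
  rw [hfst] at hprob hint
  let κ' : Kernel Y X := (Kernel.id ×ₖ κ).map e.symm
  have hκ' : ∀ y, κ' y = (κ y).map fun g => e.symm (y, g) := fun y => by
    rw [Kernel.map_apply _ e.symm.measurable, Kernel.prod_apply, Kernel.id_apply,
      Measure.dirac_prod, Measure.map_map e.symm.measurable measurable_prodMk_left]
    rfl
  have hmk : ∀ y, Measurable fun g : G => e.symm (y, g) := fun y =>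
    e.symm.measurable.comp measurable_prodMk_left
  refine ⟨κ', ⟨?_, fun f hf => ?_⟩, fun x => ?_⟩
  · filter_upwards [hprob] with y hy
    rw [hκ']
    refine ⟨Measure.isProbabilityMeasure_map (hmk y).aemeasurable, ?_⟩
    have hms : MeasurableSet ((fun x => (e x).1) ⁻¹' {y} : Set X)ᶜ :=
      ((measurable_fst.comp e.measurable) (measurableSet_singleton y)).compl
    rw [Measure.map_apply (hmk y) hms]
    convert measure_empty (μ := κ y)
    ext g
    simp
  · have h1 := hint (fun p => f (e.symm p)) (hf.comp e.symm.measurable)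
    rw [lintegral_map_equiv] at h1
    simp only [MeasurableEquiv.symm_apply_apply] at h1
    rw [h1]
    refine lintegral_congr fun y => ?_
    rw [hκ', lintegral_map hf (hmk y)]
  -- The orbit map of x is right multiplication by its group coordinate followed by the inclusion of
  -- the fibre; the former preserves the null sets of l in both directions.
  · have h1 : l.map (fun g => g • x) =
        (l.map (fun g => g * (e x).2)).map fun g => e.symm ((e x).1, g) := by
      rw [Measure.map_map (hmk _) (measurable_mul_const _)]
      congr 1
      funext g
      rw [Function.comp_apply, ← he, MeasurableEquiv.symm_apply_apply]
    rw [h1, hκ']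
    exact ⟨((hac _).1.trans (absolutelyContinuous_map_mul_right l _)).map (hmk _),
      ((quasiMeasurePreserving_mul_right l _).absolutelyContinuous.trans (hac _).2).map (hmk _)⟩

end Disintegration

/-! ### Null sets of products of nondegenerate normal distributions -/

theorem MeasureTheory.Measure.pi_absolutelyContinuous {n : ℕ} {α : Fin n → Type*}
    [∀ i, MeasurableSpace (α i)] {μ ν : ∀ i, Measure (α i)} [∀ i, SigmaFinite (μ i)]
    [∀ i, SigmaFinite (ν i)] (h : ∀ i, μ i ≪ ν i) : Measure.pi μ ≪ Measure.pi ν := by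
  induction n with
  | zero => rw [Measure.pi_of_empty μ finZeroElim, Measure.pi_of_empty ν finZeroElim]
  | succ n ih =>
    have h1 := (measurePreserving_piFinSuccAbove μ 0).symm.map_eq
    have h2 := (measurePreserving_piFinSuccAbove ν 0).symm.map_eq
    rw [← h1, ← h2]
    exact ((h 0).prod (ih fun i => h _)).map (MeasurableEquiv.measurable _)

section Affine

variable {d : ℕ}

/-- The linear automorphism of Euclidean space given by an invertible matrix. -/
noncomputable def GN.actEquiv (V : Matrix (Fin d) (Fin d) ℝ) (hV : IsUnit V.det) :
    EuclideanSpace ℝ (Fin d) ≃ₗ[ℝ] EuclideanSpace ℝ (Fin d) :=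
  LinearEquiv.ofLinearMap (Matrix.toLpLin 2 2 V) (Matrix.toLpLin 2 2 V⁻¹)
    (LinearMap.ext fun y => (GN.act_mul V V⁻¹ y).symm.trans (by
      rw [Matrix.mul_nonsing_inv _ hV, GN.act_one]; rfl))
    (LinearMap.ext fun y => (GN.act_mul V⁻¹ V y).symm.trans (by
      rw [Matrix.nonsing_inv_mul _ hV, GN.act_one]; rfl))

/-- An invertible linear map carries Lebesgue measure to an additive Haar measure, which the
translation by c leaves unchanged. -/
theorem isAddHaarMeasure_map_act_add (V : Matrix (Fin d) (Fin d) ℝ) (hV : IsUnit V.det)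
    (c : EuclideanSpace ℝ (Fin d)) :
    ((volume : Measure (EuclideanSpace ℝ (Fin d))).map
      fun y => GN.act V y + c).IsAddHaarMeasure := by
  let L := (GN.actEquiv V hV).toContinuousLinearEquiv
  have hH : ((volume : Measure (EuclideanSpace ℝ (Fin d))).map L).IsAddHaarMeasure :=
    L.isAddHaarMeasure_map volume
  have h : (volume : Measure (EuclideanSpace ℝ (Fin d))).map (fun y => GN.act V y + c) =
      (volume : Measure (EuclideanSpace ℝ (Fin d))).map L := by
    rw [← map_add_right_eq_self ((volume : Measure (EuclideanSpace ℝ (Fin d))).map L) c,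
      Measure.map_map (measurable_add_const c) L.continuous.measurable]
    rfl
  rwa [h]

end Affine

theorem stdGaussian_absolutelyContinuous (d : ℕ) :
    stdGaussian (EuclideanSpace ℝ (Fin d)) ≪ volume := by
  rw [← map_pi_eq_stdGaussian, ← (PiLp.volume_preserving_toLp (Fin d)).map_eq, volume_pi]
  exact (Measure.pi_absolutelyContinuous fun _ =>
    gaussianReal_absolutelyContinuous 0 one_ne_zero).map (WithLp.measurable_toLp 2 _)

theorem absolutelyContinuous_stdGaussian (d : ℕ) :
    volume ≪ stdGaussian (EuclideanSpace ℝ (Fin d)) := by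
  rw [← map_pi_eq_stdGaussian, ← (PiLp.volume_preserving_toLp (Fin d)).map_eq, volume_pi]
  exact (Measure.pi_absolutelyContinuous fun _ =>
    gaussianReal_absolutelyContinuous' 0 one_ne_zero).map (WithLp.measurable_toLp 2 _)

section MultivariateGaussian

variable {d : ℕ} (a : EuclideanSpace ℝ (Fin d)) {S : Matrix (Fin d) (Fin d) ℝ}

open scoped MatrixOrder in
theorem exists_multivariateGaussian_eq_map (hS : S.PosDef) :
    ∃ V : Matrix (Fin d) (Fin d) ℝ, IsUnit V.det ∧
      multivariateGaussian a S =
        (stdGaussian (EuclideanSpace ℝ (Fin d))).map fun y => GN.act V y + a := by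
  refine ⟨CFC.sqrt S, ?_, ?_⟩
  · have h1 : CFC.sqrt S * CFC.sqrt S = S := CFC.sqrt_mul_sqrt_self _ hS.posSemidef.nonneg
    have h2 : IsUnit (CFC.sqrt S * CFC.sqrt S).det := by
      rw [h1]
      exact hS.det_pos.ne'.isUnit
    rw [Matrix.det_mul] at h2
    exact isUnit_of_mul_isUnit_left h2
  · rw [multivariateGaussian]
    congr 1
    funext y
    rw [add_comm]
    rfl

theorem measurable_act_add (V : Matrix (Fin d) (Fin d) ℝ) :
    Measurable fun y => GN.act V y + a :=
  ((GN.continuous_act continuous_const continuous_id).add continuous_const).measurable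

theorem multivariateGaussian_absolutelyContinuous (hS : S.PosDef) :
    multivariateGaussian a S ≪ volume := by
  obtain ⟨V, hV, h⟩ := exists_multivariateGaussian_eq_map a hS
  have := isAddHaarMeasure_map_act_add V hV a
  rw [h]
  exact ((stdGaussian_absolutelyContinuous d).map (measurable_act_add a V)).trans
    (Measure.absolutelyContinuous_isAddHaarMeasure _ _)

theorem absolutelyContinuous_multivariateGaussian (hS : S.PosDef) :
    volume ≪ multivariateGaussian a S := by
  obtain ⟨V, hV, h⟩ := exists_multivariateGaussian_eq_map a hS
  have := isAddHaarMeasure_map_act_add V hV a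
  rw [h]
  exact (Measure.absolutelyContinuous_isAddHaarMeasure _ _).trans
    ((absolutelyContinuous_stdGaussian d).map (measurable_act_add a V))

end MultivariateGaussian

/-! ### Quasi-invariance of Lebesgue measure and negligibility of special position -/

section GeneralPosition

variable {d n : ℕ}

theorem measurable_smul_config (g : GN d) :
    Measurable fun x : Fin n → EuclideanSpace ℝ (Fin d) => g • x :=
  (continuous_const_smul g).measurable

theorem volume_map_smul_absolutelyContinuous (g : GN d) :
    (volume : Measure (Fin n → EuclideanSpace ℝ (Fin d))).map (fun x => g • x) ≪ volume := by
  have hH := isAddHaarMeasure_map_act_add g.V g.isUpperPos.isUnit_det g.m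
  have h1 : (volume : Measure (Fin n → EuclideanSpace ℝ (Fin d))).map (fun x => g • x) =
      Measure.pi fun _ => (volume : Measure (EuclideanSpace ℝ (Fin d))).map
        fun y => GN.act g.V y + g.m := by
    rw [volume_pi]
    exact Measure.pi_map_pi fun _ => (measurable_act_add g.m g.V).aemeasurable
  rw [h1, volume_pi]
  exact Measure.pi_absolutelyContinuous fun _ => Measure.absolutelyContinuous_isAddHaarMeasure _ _

/-- Along every line in a suitable direction v, the determinant testing independence is a
characteristic polynomial in the parameter, so it has finitely many zeros. Fubini along these lines
gives the claim. -/
theorem ae_affineIndependent (s : Finset (Fin n)) (hs : s.card = d + 1) :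
    ∀ᵐ x : Fin n → EuclideanSpace ℝ (Fin d), AffineIndependent ℝ fun i : s => x i := by
  obtain ⟨i₀, hi₀⟩ : s.Nonempty := Finset.card_pos.1 (by omega)
  let b : s := ⟨i₀, hi₀⟩
  have hcard : Fintype.card {i : s // i ≠ b} = d := by
    rw [Fintype.card_subtype_compl, Fintype.card_subtype_eq, Fintype.card_coe, hs,
      Nat.add_sub_cancel]
  let f : Fin d ≃ {i : s // i ≠ b} := (finCongr hcard.symm).trans (Fintype.equivFin _).symm
  let M : (Fin n → EuclideanSpace ℝ (Fin d)) → Matrix (Fin d) (Fin d) ℝ :=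
    fun x => Matrix.of fun j => (x (f j).1.1 - x i₀).ofLp
  have hM : ∀ x, (M x).det ≠ 0 → AffineIndependent ℝ fun i : s => x i := fun x hx => by
    rw [affineIndependent_iff_linearIndependent_vsub ℝ _ b, ← linearIndependent_equiv f]
    refine LinearIndependent.of_comp (WithLp.linearEquiv 2 ℝ (Fin d → ℝ)).toLinearMap ?_
    exact Matrix.linearIndependent_rows_iff_isUnit.2
      ((Matrix.isUnit_iff_isUnit_det (M x)).2 hx.isUnit)
  -- Zero at the base point and the standard basis at the other d points of s, so that moving by tv
  -- adds t times the identity to M.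
  let v : Fin n → EuclideanSpace ℝ (Fin d) :=
    fun i => ∑ j, if (f j).1.1 = i then EuclideanSpace.single j 1 else 0
  have hv0 : v i₀ = 0 := Finset.sum_eq_zero fun j _ =>
    if_neg fun h => (f j).2 (Subtype.ext h)
  have hvf : ∀ j, v (f j).1.1 = EuclideanSpace.single j 1 := fun j => by
    have h : ∀ k, ((f k).1.1 = (f j).1.1) ↔ k = j := fun k =>
      ⟨fun h => f.injective (Subtype.ext (Subtype.ext h)), fun h => by rw [h]⟩
    simp [v, h]
  have hMv : ∀ (y : Fin n → EuclideanSpace ℝ (Fin d)) (t : ℝ),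
      M (y + t • v) = Matrix.scalar (Fin d) t - -M y := fun y t => by
    ext j k
    simp only [M, Matrix.of_apply, Pi.add_apply, Pi.smul_apply, hv0, hvf, Matrix.sub_apply,
      Matrix.neg_apply, Matrix.scalar_apply, Matrix.diagonal_apply, smul_zero, add_zero,
      PiLp.sub_apply, PiLp.add_apply, PiLp.smul_apply, PiLp.single_apply, smul_eq_mul,
      eq_comm (a := k)]
    split_ifs <;> ring
  have hmeas : MeasurableSet {x : Fin n → EuclideanSpace ℝ (Fin d) |
      AffineIndependent ℝ fun i : s => x i} :=
    (isOpen_setOfPred_affineIndependent.preimage (f := fun (x : Fin n → EuclideanSpace ℝ (Fin d))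
      (i : s) => x i) (by fun_prop)).measurableSet
  refine ae_mem_of_ae_add_linearMap_mem ((LinearMap.toSpanSingleton ℝ _ v)) (volume : Measure ℝ)
    volume hmeas fun y => ?_
  have hfin : {t : ℝ | (-M y).charpoly.IsRoot t}.Finite :=
    Polynomial.finite_setOfPred_isRoot (Matrix.charpoly_monic _).ne_zero
  filter_upwards [hfin.countable.ae_notMem volume] with t ht
  refine hM _ ?_
  rw [LinearMap.toSpanSingleton_apply, hMv, ← Matrix.eval_charpoly]
  exact ht

theorem volume_specialPosition (d n : ℕ) :
    volume (specialPosition d n : Set (Fin n → EuclideanSpace ℝ (Fin d))) = 0 := by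
  have h : ∀ᵐ x : Fin n → EuclideanSpace ℝ (Fin d), InGeneralPosition x :=
    ae_all_iff.2 fun s => by
      by_cases hs : s.card = d + 1
      · filter_upwards [ae_affineIndependent s hs] with x hx _ using hx
      · exact Filter.Eventually.of_forall fun x h => absurd h hs
  exact h

end GeneralPosition

/-! ### The orbit space of the configurations in general position -/

/-- A locally closed subset is closed in an open, hence Polish, subspace. This makes the group
standard Borel, as conditional kernels require. -/
instance GN.instPolishSpace (d : ℕ) : PolishSpace (GN d) := by
  have : PolishSpace (Matrix (Fin d) (Fin d) ℝ) :=
    inferInstanceAs (PolishSpace (Fin d → Fin d → ℝ))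
  obtain ⟨U, Z, hU, hZ, h⟩ := GN.isLocallyClosed_range_coords d
  have : PolishSpace U := hU.polishSpace
  have hmem : ∀ g : GN d, g.coords ∈ U := fun g => (h.subset ⟨g, rfl⟩).1
  have hemb : IsEmbedding (Set.codRestrict (GN.coords (d := d)) U hmem) :=
    (GN.isEmbedding_coords d).codRestrict U hmem
  refine IsClosedEmbedding.polishSpace (f := Set.codRestrict (GN.coords (d := d)) U hmem)
    ⟨hemb, ?_⟩
  have hr : range (Set.codRestrict (GN.coords (d := d)) U hmem) = Subtype.val ⁻¹' Z := by
    ext p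
    constructor
    · rintro ⟨g, rfl⟩
      exact (h.subset ⟨g, rfl⟩).2
    · intro hp
      obtain ⟨g, hg⟩ := h.superset ⟨p.2, hp⟩
      exact ⟨g, Subtype.ext hg⟩
  rw [hr]
  exact hZ.preimage continuous_subtype_val

section OrbitSpace

variable {d n : ℕ}

theorem inGeneralPosition_coe (x : ↥(specialPosition d n)ᶜ) : InGeneralPosition x.1 :=
  not_not.1 x.2

theorem isClosed_specialPosition (d n : ℕ) :
    IsClosed (specialPosition d n : Set (Fin n → EuclideanSpace ℝ (Fin d))) :=
  isOpen_inGeneralPosition.isClosed_compl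

/-- Whitening, as a map from the configurations in general position to the whitened ones. -/
noncomputable def whitenSubtype (hnd : d < n) (x : ↥(specialPosition d n)ᶜ) : whitened d n :=
  ⟨whiten x.1, whiten_mem_whitened hnd x.1 (inGeneralPosition_coe x)⟩

theorem continuous_whitenSubtype (hnd : d < n) : Continuous (whitenSubtype hnd) :=
  Continuous.subtype_mk (continuous_iff_continuousAt.2 fun x =>
    ((inGeneralPosition_coe x).contDiffAt_whiten hnd).continuousAt.comp
      continuous_subtype_val.continuousAt) _

theorem OrbitSpace.mk_eq_mk {G X : Type*} [Group G] [MulAction G X] {x y : X} :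
    OrbitSpace.mk G x = OrbitSpace.mk G y ↔ ∃ g : G, g • y = x :=
  Quotient.eq (r := MulAction.orbitRel G X)

theorem OrbitSpace.continuous_mk (G X : Type*) [Group G] [MulAction G X] [TopologicalSpace X] :
    Continuous (OrbitSpace.mk G : X → OrbitSpace G X) :=
  continuous_quotient_mk'

/-- The homeomorphism from the whitened configurations to the orbit space. -/
noncomputable def whitenedHomeomorph (hnd : d < n) :
    whitened d n ≃ₜ OrbitSpace (GN d) ↥(specialPosition d n)ᶜ where
  toFun := whitenedOrbit d n
  invFun := Quotient.lift (whitenSubtype hnd) (by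
    rintro _ x ⟨g, rfl⟩
    exact Subtype.ext (whiten_smul hnd g x.1 (inGeneralPosition_coe x)))
  left_inv y := Subtype.ext (whiten_of_mem_whitened hnd y.2)
  right_inv := by
    refine Quotient.ind fun x => ?_
    exact OrbitSpace.mk_eq_mk.2 ⟨(sampleFrame hnd x.1 (inGeneralPosition_coe x))⁻¹,
      Subtype.ext (whiten_eq_smul hnd x.1 (inGeneralPosition_coe x)).symm⟩
  continuous_toFun := (OrbitSpace.continuous_mk _ _).comp
    (Continuous.subtype_mk continuous_subtype_val _)
  continuous_invFun := Continuous.quotient_lift (continuous_whitenSubtype hnd) _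

theorem whitenedHomeomorph_apply (hnd : d < n) (y : whitened d n) :
    whitenedHomeomorph hnd y = whitenedOrbit d n y := rfl

theorem whitenedHomeomorph_symm_mk (hnd : d < n) (x : ↥(specialPosition d n)ᶜ) :
    (whitenedHomeomorph hnd).symm (OrbitSpace.mk (GN d) x) = whitenSubtype hnd x := rfl

theorem continuous_sampleFrame (hnd : d < n) :
    Continuous fun x : ↥(specialPosition d n)ᶜ =>
      sampleFrame hnd x.1 (inGeneralPosition_coe x) := by
  refine (GN.isEmbedding_coords d).continuous_iff.2 ?_
  refine Continuous.prodMk (continuous_iff_continuousAt.2 fun x => ?_)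
    (contDiff_sampleMean.continuous.comp continuous_subtype_val)
  exact ((inGeneralPosition_coe x).contDiffAt_upperCholesky hnd).continuousAt.comp
    continuous_subtype_val.continuousAt

/-- The trivialization of the configurations in general position as a product of the orbit space
and the group. -/
noncomputable def orbitTrivialization (hnd : d < n) :
    ↥(specialPosition d n)ᶜ ≃ᵐ OrbitSpace (GN d) ↥(specialPosition d n)ᶜ × GN d where
  toFun x := (OrbitSpace.mk (GN d) x, sampleFrame hnd x.1 (inGeneralPosition_coe x))
  invFun p := ⟨p.2 • ((whitenedHomeomorph hnd).symm p.1).1, fun h => h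
    ((inGeneralPosition_smul_iff _ _).2 ((whitenedHomeomorph hnd).symm p.1).2.1)⟩
  left_inv x := Subtype.ext (sampleFrame_smul_whiten hnd x.1 (inGeneralPosition_coe x))
  right_inv p := by
    have hy := ((whitenedHomeomorph hnd).symm p.1).2
    refine Prod.ext ?_ ?_
    · refine Eq.trans ?_ ((whitenedHomeomorph hnd).apply_symm_apply p.1)
      exact OrbitSpace.mk_eq_mk.2 ⟨p.2, rfl⟩
    · refine (sampleFrame_smul hnd p.2 _ hy.1
        ((inGeneralPosition_smul_iff p.2 _).2 hy.1)).trans ?_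
      rw [sampleFrame_of_mem_whitened hnd hy, mul_one]
  measurable_toFun := (OrbitSpace.continuous_mk _ _).measurable.prodMk
    (continuous_sampleFrame hnd).measurable
  measurable_invFun := by
    refine Measurable.subtype_mk (measurable_snd.smul ?_)
    exact measurable_subtype_coe.comp
      ((whitenedHomeomorph hnd).symm.continuous.measurable.comp measurable_fst)

theorem orbitTrivialization_smul (hnd : d < n) (g : GN d) (x : ↥(specialPosition d n)ᶜ) :
    orbitTrivialization hnd (g • x) =
      ((orbitTrivialization hnd x).1, g * (orbitTrivialization hnd x).2) :=
  Prod.ext (OrbitSpace.mk_eq_mk.2 ⟨g, rfl⟩)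
    (sampleFrame_smul hnd g x.1 (inGeneralPosition_coe x) (inGeneralPosition_coe (g • x)))

/-- Every probability measure with the null sets of Lebesgue measure is orbit-regular. -/
theorem isOrbitRegularWith_specialPosition (hnd : d < n)
    (μ : Measure (Fin n → EuclideanSpace ℝ (Fin d))) [IsProbabilityMeasure μ]
    (h1 : μ ≪ volume) (h2 : volume ≪ μ) : IsOrbitRegularWith μ (specialPosition d n) where
  isClosed := isClosed_specialPosition d n
  null := h1 (volume_specialPosition d n)
  free x hx g hg := (not_not.1 hx : InGeneralPosition x).eq_one_of_smul_eq hnd hg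
  disintegration := by
    have hval : MeasurableEmbedding
        (Subtype.val : ↥(specialPosition d n)ᶜ → Fin n → EuclideanSpace ℝ (Fin d)) :=
      MeasurableEmbedding.subtype_coe (isClosed_specialPosition d n).measurableSet.compl
    have hcs : MeasurableConstSMul (GN d) ↥(specialPosition d n)ᶜ :=
      ⟨fun g => Measurable.subtype_mk ((measurable_smul_config g).comp measurable_subtype_coe)⟩
    -- Inherited from N; it makes points of the orbit space measurable, as the fibre condition
    -- needs.
    have hT1 : T1Space (OrbitSpace (GN d) ↥(specialPosition d n)ᶜ) :=
      (whitenedHomeomorph hnd).symm.isEmbedding.t1Space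
    have hfin : IsFiniteMeasure
        (μ.comap (Subtype.val : ↥(specialPosition d n)ᶜ → Fin n → EuclideanSpace ℝ (Fin d))) :=
      ⟨by rw [hval.comap_apply]; exact measure_lt_top _ _⟩
    have hne : NeZero (Measure.haar : Measure (GN d)) :=
      ⟨fun h => isOpen_univ.measure_ne_zero (Measure.haar : Measure (GN d)) univ_nonempty
        (by rw [h]; rfl)⟩
    refine exists_isDisintegration_of_trivialization Measure.haar _ (fun g => ?_)
      (orbitTrivialization hnd) (orbitTrivialization_smul hnd)
    refine Measure.AbsolutelyContinuous.mk fun A hA h => ?_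
    rw [hval.comap_apply] at h
    rw [Measure.map_apply (measurable_const_smul g) hA, hval.comap_apply]
    -- Quasi-invariance of μ is borrowed from Lebesgue measure through the equivalence of the two.
    have hq : μ.map (fun x => g • x) ≪ μ :=
      ((h1.map (measurable_smul_config g)).trans (volume_map_smul_absolutelyContinuous g)).trans h2
    have h3 := hq h
    rw [Measure.map_apply (measurable_smul_config g) (hval.measurableSet_image.2 hA)] at h3
    refine measure_mono_null ?_ h3
    rintro _ ⟨x, hx, rfl⟩
    exact ⟨g • x, hx, rfl⟩

end OrbitSpace

theorem mainTheorem7 (d n : ℕ) (hnd : d < n) :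
    -- orbit regularity for products of nondegenerate normal distributions
    (∀ (a : Fin n → EuclideanSpace ℝ (Fin d)) (S : Fin n → Matrix (Fin d) (Fin d) ℝ),
      (∀ i, (S i).PosDef) →
        IsOrbitRegular (GN d) (Measure.pi fun i => multivariateGaussian (a i) (S i)) ∧
        IsOrbitRegularWith (Measure.pi fun i => multivariateGaussian (a i) (S i))
          (specialPosition d n)) ∧
    -- the whitened configurations form a smooth submanifold
    IsSmoothSubmanifold (n * d - (d + d * (d + 1) / 2)) (whitened d n) ∧
    -- configurations in general position are diffeomorphic to `N × G`
    IsDiffeoOn whitenCoords unwhiten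
      {x : Fin n → EuclideanSpace ℝ (Fin d) | InGeneralPosition x}
      (whitened d n ×ˢ range (GN.coords (d := d))) ∧
    -- the orbit space is identified with `N`, the quotient map becoming the whitening map
    (∃ h : whitened d n ≃ₜ OrbitSpace (GN d) ↥(specialPosition d n)ᶜ,
      (∀ y, h y = whitenedOrbit d n y) ∧
      ∀ x : ↥(specialPosition d n)ᶜ, (h.symm (OrbitSpace.mk (GN d) x)).1 = whiten x.1) ∧
    -- and the whitening map is a submersion onto `N`
    (∀ x : Fin n → EuclideanSpace ℝ (Fin d), InGeneralPosition x →
      Module.finrank ℝ (fderiv ℝ (whiten (d := d) (n := n)) x).range =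
        n * d - (d + d * (d + 1) / 2)) := by
  have key : ∀ (a : Fin n → EuclideanSpace ℝ (Fin d)) (S : Fin n → Matrix (Fin d) (Fin d) ℝ),
      (∀ i, (S i).PosDef) → IsOrbitRegularWith
        (Measure.pi fun i => multivariateGaussian (a i) (S i)) (specialPosition d n) :=
    fun a S hS => isOrbitRegularWith_specialPosition hnd _
      (Measure.pi_absolutelyContinuous fun i =>
        multivariateGaussian_absolutelyContinuous (a i) (hS i))
      (Measure.pi_absolutelyContinuous fun i =>
        absolutelyContinuous_multivariateGaussian (a i) (hS i))
  exact ⟨fun a S hS => ⟨⟨_, key a S hS⟩, key a S hS⟩, isSmoothSubmanifold_whitened hnd,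
    isDiffeoOn_whitenCoords hnd, ⟨whitenedHomeomorph hnd, whitenedHomeomorph_apply hnd,
      fun x => congrArg Subtype.val (whitenedHomeomorph_symm_mk hnd x)⟩,
    fun x hx => hx.finrank_range_fderiv_whiten hnd⟩
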